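/- For a positive integer $n$, let $\Omega(n)$ denote the number of prime factors of $n$ counted with multiplicity (so $\Omega(1)=0$). A real sequence $(x_n)_{n\ge 1}$ is called uniformly distributed mod $1$ if, for all real numbers $a,b$ with $0\le a<b\le 1$, $$\lim_{N\to\infty}\frac1N\,\#\bigl\{1\le n\le N:\ \{x_n\}\in[a,b)\bigr\}=b-a,$$ where $\{x\}=x-\lfloor x\rfloor$ is the fractional part of $x$. Let $Q(t)=c_kt^k+\dots+c_1t+c_0$ be a polynomial with real coefficients. Then the sequence $\bigl(Q(\Omega(n))\bigr)_{n\ge1}$ is uniformly distributed mod $1$ if and only if at least one of the coefficients $c_1,\dots,c_k$ is irrational. -/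

import Mathlib

/-- A real sequence `x 1, x 2, x 3, …` is uniformly distributed mod `1` if, for all
`0 ≤ a < b ≤ 1`, the proportion of indices `n ∈ {1, …, N}` for which the fractional part of
`x n` lies in `[a, b)` tends to `b - a` as `N → ∞`. The value `x 0` is not used. -/
def IsUniformlyDistributedModOne (x : ℕ → ℝ) : Prop :=
  ∀ a b : ℝ, 0 ≤ a → a < b → b ≤ 1 →
    Filter.Tendsto
      (fun N : ℕ =>
        (({n ∈ Finset.Icc 1 N | Int.fract (x n) ∈ Set.Ico a b}).card : ℝ) / (N : ℝ))
      Filter.atTop (nhds (b - a))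

open Filter Topology Finset
open ArithmeticFunction (cardFactors)


/-! If `c₁, …, c_k` are all rational with common denominator `q`, then `q * Q(Ω n)` is constant mod
1, so the values `Q(Ω n)` miss an interval.

For the converse, the main point is that the distribution of `Ω n` for `n ≤ N` is asymptotically
invariant under shift by 1, for bounded test functions (`tendsto_mean_shift_cardFactors`). Given
this, the average of `a (Ω n)` may be replaced by that of `a (Ω n + h)` averaged over `h < H`. This
is small as soon as `a` has small means over all long intervals, uniformly in their position. For `a
k = exp (2πi Q(k))` that is Weyl's theorem, proved by van der Corput differencing, and Weyl's
criterion concludes.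

Shift invariance is elementary. Let `g k m` be the limit along an ultrafilter of the mean of `a (Ω n
+ k)` over `n ≤ N / m`. Since `Ω (p * n) = Ω n + 1`, a Turán–Kubilius inequality gives `g (k + 1) (m
* p) ≈ g k m` for all primes `p` outside a set with convergent sum of reciprocals. Hence `g (M + 2)
T ≈ g 0 1` if `T` is a product of `M + 2` suitable primes, and `g (M + 2) S ≈ g 1 1` if `S` is a
product of `M + 1` such primes. As `g k` varies slowly in `m`, it suffices to find such `S` and `T`
with ratio near 1. Chebyshev's bounds only place the ratio within a constant factor. A ladder of
products of `M` primes, with consecutive ratios between `1 + δ` and `1 + ε` and spanning that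
factor, supplies the fine tuning (`IsPrimeStable.exists_ladder`, `IsPrimeStable.eq_shift`). -/

/-! ### Turán–Kubilius: variance of weighted prime divisor counts. -/

/-- For `p ≠ q` coprimality makes the main terms `M / (p * q)` cancel, leaving only floor errors,
which the constant 4 absorbs. The diagonal contributes the variance, at most `M / p` up to the same
errors. -/
lemma abs_sum_dvd_covariance_le {p q : ℕ} (hp : p.Prime) (hq : q.Prime) (M : ℕ) :
    |∑ n ∈ Ioc 0 M, ((if p ∣ n then (1 : ℝ) else 0) - 1 / p) *
      ((if q ∣ n then (1 : ℝ) else 0) - 1 / q)| ≤ (if p = q then (M : ℝ) / p else 0) + 4 := by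
  have hcount : ∀ d : ℕ, ∑ n ∈ Ioc 0 M, (if d ∣ n then (1 : ℝ) else 0) = ((M / d : ℕ) : ℝ) := by
    intro d
    rw [Finset.sum_boole, Nat.Ioc_filter_dvd_card_eq_div]
  have hfl : ∀ d : ℕ, 0 < d → (M : ℝ) / d - 1 ≤ ((M / d : ℕ) : ℝ) ∧
      ((M / d : ℕ) : ℝ) ≤ (M : ℝ) / d := by
    intro d hd
    refine ⟨?_, Nat.cast_div_le⟩
    rw [← Nat.floor_div_eq_div (K := ℝ)]
    exact (Nat.sub_one_lt_floor _).le
  have hp2 : (2 : ℝ) ≤ p := by exact_mod_cast hp.two_le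
  have hq2 : (2 : ℝ) ≤ q := by exact_mod_cast hq.two_le
  have hpinv : (1 : ℝ) / p ≤ 1 / 2 := one_div_le_one_div_of_le (by norm_num) hp2
  have hqinv : (1 : ℝ) / q ≤ 1 / 2 := one_div_le_one_div_of_le (by norm_num) hq2
  have hp0 : (0 : ℝ) ≤ 1 / p := by positivity
  have hq0 : (0 : ℝ) ≤ 1 / q := by positivity
  have hexp : ∑ n ∈ Ioc 0 M, ((if p ∣ n then (1 : ℝ) else 0) - 1 / p) *
      ((if q ∣ n then (1 : ℝ) else 0) - 1 / q) =
      ∑ n ∈ Ioc 0 M, (if p ∣ n ∧ q ∣ n then (1 : ℝ) else 0) - 1 / q * ((M / p : ℕ) : ℝ)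
        - 1 / p * ((M / q : ℕ) : ℝ) + M * (1 / p * (1 / q)) := by
    rw [← hcount p, ← hcount q, Finset.mul_sum, Finset.mul_sum, ← Finset.sum_sub_distrib,
      ← Finset.sum_sub_distrib]
    have : (M : ℝ) * (1 / p * (1 / q)) = ∑ n ∈ Ioc 0 M, (1 / p * (1 / q) : ℝ) := by simp
    rw [this, ← Finset.sum_add_distrib]
    refine Finset.sum_congr rfl fun n _ => ?_
    by_cases h1 : p ∣ n <;> by_cases h2 : q ∣ n <;> simp [h1, h2] <;> ring
  rw [hexp]
  obtain ⟨a1, a2⟩ := hfl p hp.pos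
  obtain ⟨b1, b2⟩ := hfl q hq.pos
  set x : ℝ := 1 / p
  set y : ℝ := 1 / q
  have hMp : (M : ℝ) / p = M * x := by simp [x, div_eq_mul_inv]
  have hMq : (M : ℝ) / q = M * y := by simp [y, div_eq_mul_inv]
  rw [hMp] at a1 a2
  rw [hMq] at b1 b2
  have hM : (0 : ℝ) ≤ M := by positivity
  split_ifs with h
  · subst h
    simp only [and_self]
    rw [hcount, hMp]
    change |_ - x * _ - x * _ + _ * (x * x)| ≤ _
    have hMx : 0 ≤ M * x := by positivity
    rw [abs_le]
    constructor <;> nlinarith [mul_nonneg hp0 hMx]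
  · have hc : ∀ n, (p ∣ n ∧ q ∣ n) ↔ p * q ∣ n := fun n =>
      ⟨fun h' => ((Nat.coprime_primes hp hq).2 h).mul_dvd_of_dvd_of_dvd h'.1 h'.2,
        fun h' => ⟨(dvd_mul_right _ _).trans h', (dvd_mul_left _ _).trans h'⟩⟩
    simp only [hc]
    rw [hcount]
    obtain ⟨c1, c2⟩ := hfl (p * q) (Nat.mul_pos hp.pos hq.pos)
    have hMpq : (M : ℝ) / (p * q : ℕ) = M * (x * y) := by
      simp [x, y, div_eq_mul_inv, mul_comm]
    rw [hMpq] at c1 c2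
    rw [abs_le]
    constructor <;> nlinarith

lemma sum_sq_sum_dvd_le (P : Finset ℕ) (hP : ∀ p ∈ P, p.Prime) (e : ℕ → ℝ)
    (he : ∀ p, |e p| ≤ 1) (M : ℕ) :
    ∑ n ∈ Ioc 0 M, (∑ p ∈ P, e p * ((if p ∣ n then (1 : ℝ) else 0) - 1 / p)) ^ 2 ≤
      M * ∑ p ∈ P, (1 : ℝ) / p + 4 * (#P : ℝ) ^ 2 := by
  have h1 : ∑ n ∈ Ioc 0 M, (∑ p ∈ P, e p * ((if p ∣ n then (1 : ℝ) else 0) - 1 / p)) ^ 2 =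
      ∑ p ∈ P, ∑ q ∈ P, e p * e q * ∑ n ∈ Ioc 0 M, ((if p ∣ n then (1 : ℝ) else 0) - 1 / p) *
        ((if q ∣ n then (1 : ℝ) else 0) - 1 / q) := by
    simp_rw [sq, Finset.sum_mul_sum, Finset.mul_sum]
    rw [Finset.sum_comm]
    refine Finset.sum_congr rfl fun p _ => ?_
    rw [Finset.sum_comm]
    refine Finset.sum_congr rfl fun q _ => Finset.sum_congr rfl fun n _ => ?_
    ring
  rw [h1]
  calc _ ≤ ∑ p ∈ P, ∑ q ∈ P, ((if p = q then (M : ℝ) / p else 0) + 4) := by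
        refine Finset.sum_le_sum fun p hp => Finset.sum_le_sum fun q hq => ?_
        refine (le_abs_self _).trans ?_
        rw [abs_mul, abs_mul]
        refine le_trans ?_ (abs_sum_dvd_covariance_le (hP p hp) (hP q hq) M)
        refine mul_le_of_le_one_left (abs_nonneg _) ?_
        exact mul_le_one₀ (he p) (abs_nonneg _) (he q)
    _ = _ := by
        simp only [Finset.sum_add_distrib, Finset.sum_ite_eq, Finset.sum_const, nsmul_eq_mul]
        rw [Finset.sum_congr rfl (g := fun p : ℕ => (M : ℝ) * (1 / p))
          (fun p hp => by rw [if_pos hp]; ring), ← Finset.mul_sum]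
        ring

/-! ### Averages over `n ≤ N / m` and their limits. -/

/-- The average of `a (Ω n)` over `n ≤ N / m`, normalised by `N / m`. -/
noncomputable def cardFactorsMean (a : ℕ → ℝ) (N m : ℕ) : ℝ :=
  (m : ℝ) / N * ∑ n ∈ Ioc 0 (N / m), a (cardFactors n)

lemma abs_cardFactorsMean_le {a : ℕ → ℝ} (ha : ∀ k, |a k| ≤ 1) (N m : ℕ) :
    |cardFactorsMean a N m| ≤ 1 := by
  unfold cardFactorsMean
  rw [abs_mul, abs_of_nonneg (by positivity : (0 : ℝ) ≤ (m : ℝ) / N)]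
  have h : |∑ n ∈ Ioc 0 (N / m), a (cardFactors n)| ≤ ((N / m : ℕ) : ℝ) := by
    refine (Finset.abs_sum_le_sum_abs _ _).trans ?_
    refine (Finset.sum_le_card_nsmul _ _ 1 fun n _ => ha _).trans ?_
    simp
  refine (mul_le_mul_of_nonneg_left (h.trans Nat.cast_div_le) (by positivity)).trans ?_
  rcases Nat.eq_zero_or_pos m with rfl | hm
  · simp
  rcases Nat.eq_zero_or_pos N with rfl | hN
  · simp
  have : (0 : ℝ) < m := by exact_mod_cast hm
  have : (0 : ℝ) < N := by exact_mod_cast hN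
  apply le_of_eq
  field_simp

/-- Substitution of `p * n` for `n`, under which `Ω` grows by exactly 1. -/
lemma sum_cardFactors_add_one (a : ℕ → ℝ) {p : ℕ} (hp : p.Prime) (M : ℕ) :
    ∑ n ∈ Ioc 0 (M / p), a (cardFactors n + 1) =
      ∑ n ∈ Ioc 0 M, a (cardFactors n) * (if p ∣ n then (1 : ℝ) else 0) := by
  simp only [mul_ite, mul_one, mul_zero]
  rw [← Finset.sum_filter]
  refine Finset.sum_bij (fun n _ => p * n) ?_ ?_ ?_ ?_
  · intro n hn
    simp only [mem_Ioc, mem_filter] at hn ⊢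
    exact ⟨⟨Nat.mul_pos hp.pos hn.1, by
      rw [mul_comm]; exact (Nat.le_div_iff_mul_le hp.pos).1 hn.2⟩, dvd_mul_right _ _⟩
  · intro n _ n' _ h
    exact Nat.eq_of_mul_eq_mul_left hp.pos h
  · intro n hn
    simp only [mem_Ioc, mem_filter] at hn
    obtain ⟨⟨h0, hM⟩, c, rfl⟩ := hn
    refine ⟨c, ?_, rfl⟩
    simp only [mem_Ioc]
    exact ⟨Nat.pos_of_mul_pos_left h0, by
      rw [Nat.le_div_iff_mul_le hp.pos, mul_comm]; exact hM⟩
  · intro n hn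
    simp only [mem_Ioc] at hn
    rw [ArithmeticFunction.cardFactors_mul hp.ne_zero (by omega),
      ArithmeticFunction.cardFactors_apply_prime hp, add_comm]

/-- A Turán–Kubilius type inequality for averages of functions of `Ω`. -/
lemma sum_mul_cardFactorsMean_sub_le {a : ℕ → ℝ} (ha : ∀ k, |a k| ≤ 1) (P : Finset ℕ)
    (hP : ∀ p ∈ P, p.Prime) (e : ℕ → ℝ) (he : ∀ p, |e p| ≤ 1) {m N : ℕ} (hm : 0 < m)
    (hN : 0 < N) :
    ∑ p ∈ P, e p / p * (cardFactorsMean (fun k => a (k + 1)) N (m * p) - cardFactorsMean a N m) ≤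
      √(∑ p ∈ P, (1 : ℝ) / p + 4 * (#P : ℝ) ^ 2 * (m / N)) := by
  set M := N / m with hM
  have hm' : (0 : ℝ) < m := by exact_mod_cast hm
  have hN' : (0 : ℝ) < N := by exact_mod_cast hN
  set w : ℕ → ℝ := fun n => ∑ p ∈ P, e p * ((if p ∣ n then (1 : ℝ) else 0) - 1 / p) with hw
  have h1 : ∑ p ∈ P, e p / p *
      (cardFactorsMean (fun k => a (k + 1)) N (m * p) - cardFactorsMean a N m) =
      m / N * ∑ n ∈ Ioc 0 M, a (cardFactors n) * w n := by
    simp only [hw, Finset.mul_sum]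
    rw [Finset.sum_comm]
    refine Finset.sum_congr rfl fun p hp => ?_
    have hp' : (0 : ℝ) < p := by exact_mod_cast (hP p hp).pos
    unfold cardFactorsMean
    rw [← Nat.div_div_eq_div_mul, ← hM, sum_cardFactors_add_one a (hP p hp) M]
    push_cast
    simp only [mul_sub, Finset.mul_sum, ← Finset.sum_sub_distrib]
    refine Finset.sum_congr rfl fun n _ => ?_
    field_simp
  rw [h1]
  apply Real.le_sqrt_of_sq_le
  have hMN : (m : ℝ) / N * M ≤ 1 := by
    rw [div_mul_eq_mul_div, div_le_one hN']
    exact_mod_cast Nat.mul_div_le N m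
  -- Cauchy–Schwarz removes the arbitrary `a`; the second moment of `w` is the variance bound.
  have hcs := Finset.sum_mul_sq_le_sq_mul_sq (Ioc 0 M)
    (fun n => a (cardFactors n)) w
  have ha2 : ∑ n ∈ Ioc 0 M, a (cardFactors n) ^ 2 ≤ M := by
    refine (Finset.sum_le_card_nsmul _ _ 1 fun n _ => ?_).trans (by simp)
    exact (sq_le_one_iff_abs_le_one _).2 (ha _)
  have hvar := sum_sq_sum_dvd_le P hP e he M
  have hL : 0 ≤ ∑ p ∈ P, (1 : ℝ) / p := Finset.sum_nonneg fun _ _ => by positivity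
  set L := ∑ p ∈ P, (1 : ℝ) / p
  set S := ∑ n ∈ Ioc 0 M, a (cardFactors n) * w n
  have hS : S ^ 2 ≤ M * (M * L + 4 * (#P : ℝ) ^ 2) := by
    refine hcs.trans ?_
    refine mul_le_mul ha2 hvar (Finset.sum_nonneg fun _ _ => sq_nonneg _) (by positivity)
  calc (m / N * S) ^ 2 = (m / N : ℝ) ^ 2 * S ^ 2 := by ring
    _ ≤ (m / N : ℝ) ^ 2 * (M * (M * L + 4 * (#P : ℝ) ^ 2)) := by gcongr
    _ = (m / N * M : ℝ) * ((m / N * M) * L + 4 * (#P : ℝ) ^ 2 * (m / N)) := by ring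
    _ ≤ 1 * (1 * L + 4 * (#P : ℝ) ^ 2 * (m / N)) := by gcongr
    _ = _ := by ring

/-- The weights `e p` are free in `[-1, 1]`; taking them to be the signs of the differences gives
absolute values. -/
lemma sum_div_mul_abs_cardFactorsMean_sub_le {a : ℕ → ℝ} (ha : ∀ k, |a k| ≤ 1) (P : Finset ℕ)
    (hP : ∀ p ∈ P, p.Prime) {m N : ℕ} (hm : 0 < m) (hN : 0 < N) :
    ∑ p ∈ P, 1 / (p : ℝ) *
        |cardFactorsMean (fun k => a (k + 1)) N (m * p) - cardFactorsMean a N m| ≤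
      √(∑ p ∈ P, (1 : ℝ) / p + 4 * (#P : ℝ) ^ 2 * (m / N)) := by
  refine le_trans (le_of_eq ?_) (sum_mul_cardFactorsMean_sub_le ha P hP
    (fun p => ((SignType.sign (cardFactorsMean (fun k => a (k + 1)) N (m * p) -
      cardFactorsMean a N m) : SignType) : ℝ)) (fun p => ?_) hm hN)
  · refine Finset.sum_congr rfl fun p _ => ?_
    rw [← sign_mul_self (_ - _)]
    ring
  · rcases SignType.sign (cardFactorsMean (fun k => a (k + 1)) N (m * p) -
      cardFactorsMean a N m) <;> simp

/-- Passing from `m` to `m'` changes both the range and the normalisation, each at a cost `1 - m /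
m'`; the term `m / N` pays for one floor. -/
lemma abs_cardFactorsMean_sub_le {a : ℕ → ℝ} (ha : ∀ k, |a k| ≤ 1) {m m' N : ℕ} (hm : 0 < m)
    (hmm : m ≤ m') (hN : 0 < N) :
    |cardFactorsMean a N m - cardFactorsMean a N m'| ≤ 2 * (1 - (m : ℝ) / m') + m / N := by
  have hm0 : (0 : ℝ) < m := by exact_mod_cast hm
  have hm0' : (0 : ℝ) < m' := by exact_mod_cast hm.trans_le hmm
  have hN0 : (0 : ℝ) < N := by exact_mod_cast hN
  have hle : N / m' ≤ N / m := Nat.div_le_div_left hmm hm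
  have hmm' : (m : ℝ) ≤ m' := by exact_mod_cast hmm
  set f : ℕ → ℝ := fun n => a (cardFactors n)
  have hsplit : ∑ n ∈ Ioc 0 (N / m), f n =
      ∑ n ∈ Ioc 0 (N / m'), f n + ∑ n ∈ Ioc (N / m') (N / m), f n :=
    (Finset.sum_Ioc_consecutive f (Nat.zero_le _) hle).symm
  have hb : ∀ u v : ℕ, u ≤ v → |∑ n ∈ Ioc u v, f n| ≤ (v : ℝ) - u := by
    intro u v huv
    refine (Finset.abs_sum_le_sum_abs _ _).trans ?_
    refine (Finset.sum_le_card_nsmul _ _ 1 fun n _ => ha _).trans ?_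
    simp [Nat.cast_sub huv]
  have h1 := hb _ _ hle
  have h2 := hb 0 (N / m') (Nat.zero_le _)
  have h3 : ((N / m : ℕ) : ℝ) ≤ N / m := Nat.cast_div_le
  have h4 : (N : ℝ) / m' - 1 ≤ ((N / m' : ℕ) : ℝ) := by
    rw [← Nat.floor_div_eq_div (K := ℝ)]
    exact (Nat.sub_one_lt_floor _).le
  have h5 : ((N / m' : ℕ) : ℝ) ≤ N / m' := Nat.cast_div_le
  have heq : cardFactorsMean a N m - cardFactorsMean a N m' =
      m / N * ∑ n ∈ Ioc (N / m') (N / m), f n - (m' - m) / N * ∑ n ∈ Ioc 0 (N / m'), f n := by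
    unfold cardFactorsMean
    change m / N * ∑ n ∈ Ioc 0 (N / m), f n - m' / N * ∑ n ∈ Ioc 0 (N / m'), f n = _
    rw [hsplit]
    ring
  rw [heq]
  refine (abs_sub _ _).trans ?_
  rw [abs_mul, abs_mul, abs_of_nonneg (by positivity : (0 : ℝ) ≤ m / N),
    abs_of_nonneg (div_nonneg (by linarith) hN0.le : (0 : ℝ) ≤ (m' - m) / N)]
  have hA : (m : ℝ) / N * |∑ n ∈ Ioc (N / m') (N / m), f n| ≤ m / N * (N / m - (N / m' - 1)) := by
    refine mul_le_mul_of_nonneg_left ?_ (by positivity)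
    linarith
  have hB : ((m' : ℝ) - m) / N * |∑ n ∈ Ioc 0 (N / m'), f n| ≤ (m' - m) / N * (N / m') := by
    refine mul_le_mul_of_nonneg_left ?_ (div_nonneg (by linarith) hN0.le)
    simp only [Nat.cast_zero, sub_zero] at h2
    linarith
  refine (add_le_add hA hB).trans (le_of_eq ?_)
  field_simp
  ring

/-- Limits of the averages of `a (Ω n + k)` over `n ≤ N / m` along an ultrafilter. -/
lemma exists_ultrafilter_limits {a : ℕ → ℝ} (ha : ∀ k, |a k| ≤ 1) (U : Ultrafilter ℕ)
    (hU : (U : Filter ℕ) ≤ atTop) :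
    ∃ g : ℕ → ℕ → ℝ,
      (∀ k m, Tendsto (fun N => cardFactorsMean (fun j => a (j + k)) N m) U (𝓝 (g k m))) ∧
      (∀ k m, 0 < m → ∀ P : Finset ℕ, (∀ p ∈ P, p.Prime) →
        ∑ p ∈ P, 1 / (p : ℝ) * |g (k + 1) (m * p) - g k m| ≤ √(∑ p ∈ P, (1 : ℝ) / p)) ∧
      (∀ k m m', 0 < m → m ≤ m' → |g k m - g k m'| ≤ 2 * (1 - (m : ℝ) / m')) := by
  have hex : ∀ k m, ∃ x : ℝ,
      Tendsto (fun N => cardFactorsMean (fun j => a (j + k)) N m) U (𝓝 x) := by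
    intro k m
    -- The means lie in the compact `[-1, 1]`, so one ultrafilter yields limits for all `k` and `m`
    -- at once.
    obtain ⟨x, -, hx⟩ := (isCompact_Icc (a := (-1 : ℝ)) (b := 1)).ultrafilter_le_nhds
      (U.map fun N => cardFactorsMean (fun j => a (j + k)) N m) (by
        rw [le_principal_iff, Ultrafilter.mem_coe, Ultrafilter.mem_map]
        exact Filter.univ_mem' fun N =>
          abs_le.1 (abs_cardFactorsMean_le (fun j => ha (j + k)) N m))
    exact ⟨x, hx⟩
  choose g hg using hex
  have hzero : ∀ c : ℝ, Tendsto (fun N : ℕ => c / N) U (𝓝 0) := fun c =>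
    (tendsto_const_div_atTop_nhds_zero_nat c).mono_left hU
  have hpos : ∀ᶠ N : ℕ in (U : Filter ℕ), 0 < N := hU (eventually_gt_atTop 0)
  refine ⟨g, hg, ?_, ?_⟩
  · intro k m hm P hP
    have hl : Tendsto (fun N => ∑ p ∈ P, 1 / (p : ℝ) *
        |cardFactorsMean (fun j => a (j + (k + 1))) N (m * p) -
          cardFactorsMean (fun j => a (j + k)) N m|) U
        (𝓝 (∑ p ∈ P, 1 / (p : ℝ) * |g (k + 1) (m * p) - g k m|)) :=
      tendsto_finsetSum _ fun p _ => (((hg (k + 1) (m * p)).sub (hg k m)).abs).const_mul _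
    have hr : Tendsto (fun N : ℕ => √(∑ p ∈ P, (1 : ℝ) / p + 4 * (#P : ℝ) ^ 2 * (m / N))) U
        (𝓝 (√(∑ p ∈ P, (1 : ℝ) / p + 4 * (#P : ℝ) ^ 2 * 0))) :=
      (tendsto_const_nhds.add ((hzero m).const_mul _)).sqrt
    rw [mul_zero, add_zero] at hr
    refine le_of_tendsto_of_tendsto hl hr ?_
    filter_upwards [hpos] with N hN
    have := sum_div_mul_abs_cardFactorsMean_sub_le (fun j => ha (j + k)) P hP hm hN
    simpa only [add_right_comm _ 1 k, add_assoc] using this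
  · intro k m m' hm hmm
    have hr : Tendsto (fun N : ℕ => 2 * (1 - (m : ℝ) / m') + m / N) U
        (𝓝 (2 * (1 - (m : ℝ) / m') + 0)) := tendsto_const_nhds.add (hzero m)
    rw [add_zero] at hr
    refine le_of_tendsto_of_tendsto ((hg k m).sub (hg k m')).abs hr ?_
    filter_upwards [hpos] with N hN
    exact abs_cardFactorsMean_sub_le (fun j => ha (j + k)) hm hmm hN


/-! ### Upper bound for primes in short intervals. -/

lemma prime_dvd_choose_add {p x h : ℕ} (hp : p.Prime) (hx : x < p) (hh : h ≤ x)
    (hpx : p ≤ x + h) : p ∣ (x + h).choose h := by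
  have h1 := Nat.add_choose_mul_factorial_mul_factorial x h
  have h2 : p ∣ (x + h).choose h * x.factorial * h.factorial := by
    rw [h1]
    exact (hp.dvd_factorial).2 hpx
  rcases (hp.dvd_mul).1 h2 with h3 | h3
  · rcases (hp.dvd_mul).1 h3 with h4 | h4
    · exact h4
    · exact absurd ((hp.dvd_factorial).1 h4) (by omega)
  · exact absurd ((hp.dvd_factorial).1 h3) (by omega)

lemma log_choose_le {n h : ℕ} (hh : 0 < h) (hn : h ≤ n) :
    Real.log (n.choose h) ≤ h * (1 + Real.log (n / h)) := by
  have hh' : (0 : ℝ) < h := by exact_mod_cast hh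
  have hn' : (0 : ℝ) < n := by exact_mod_cast hh.trans_le hn
  have h1 : (n.choose h : ℝ) ≤ (n / h : ℝ) ^ h * Real.exp h := by
    calc (n.choose h : ℝ) ≤ (n : ℝ) ^ h / h.factorial := Nat.choose_le_pow_div h n
      _ = (n / h : ℝ) ^ h * ((h : ℝ) ^ h / h.factorial) := by
          rw [div_pow]
          field_simp
      _ ≤ _ := by
          gcongr
          exact Real.pow_div_factorial_le_exp _ hh'.le h
  have h2 : (0 : ℝ) < n.choose h := by exact_mod_cast Nat.choose_pos hn
  refine (Real.log_le_log h2 h1).trans (le_of_eq ?_)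
  rw [Real.log_mul (by positivity) (by positivity), Real.log_pow, Real.log_exp]
  ring

/-- All primes in `(x, x + h]` divide `(x + h).choose h`, whose size limits their number. -/
lemma card_primes_mul_log_le {x h : ℕ} (hh : 0 < h) (hx : h ≤ x) :
    (#{p ∈ Ioc x (x + h) | p.Prime} : ℝ) * Real.log (x + 1) ≤
      h * (1 + Real.log ((x + h : ℕ) / h)) := by
  refine le_trans ?_ (log_choose_le hh (by omega))
  rw [← Real.log_pow]
  refine Real.log_le_log (by positivity) ?_
  have hdvd : ∏ p ∈ Ioc x (x + h) with p.Prime, p ∣ (x + h).choose h := by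
    refine Finset.prod_primes_dvd _ (fun p hp => (mem_filter.1 hp).2.prime) fun p hp => ?_
    simp only [mem_filter, mem_Ioc] at hp
    exact prime_dvd_choose_add hp.2 hp.1.1 hx hp.1.2
  have hle := Nat.le_of_dvd (Nat.choose_pos (by omega)) hdvd
  have hpow : (x + 1) ^ #{p ∈ Ioc x (x + h) | p.Prime} ≤
      ∏ p ∈ Ioc x (x + h) with p.Prime, p :=
    Finset.pow_card_le_prod _ _ _ fun p hp => (mem_Ioc.1 (mem_filter.1 hp).1).1
  exact_mod_cast hpow.trans hle

/-- Short multiplicative intervals contain a small proportion of primes. -/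
lemma exists_short_interval_prime_bound {ε : ℝ} (hε : 0 < ε) :
    ∃ δ : ℝ, 0 < δ ∧ ∃ x₀ : ℕ, ∀ p₀ : ℕ, x₀ ≤ p₀ → ∀ P : Finset ℕ,
      (∀ p ∈ P, p.Prime ∧ p₀ ≤ p ∧ (p : ℝ) ≤ (1 + δ) * p₀) →
      ∑ p ∈ P, (1 : ℝ) / p ≤ ε / Real.log p₀ := by
  -- With `h ≤ 2δp₀` and `log t ≤ 2(√t - 1)`, the count reduces to `h√t ≤ 2√δ p₀ ≤ (ε / 2) p₀`,
  -- hence `ε ^ 2 / 16`. The bound `1 / 4` ensures `h ≤ x`.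
  set δ : ℝ := min (ε ^ 2 / 16) (1 / 4) with hδ
  have hδ0 : 0 < δ := by positivity
  have hδ1 : δ ≤ ε ^ 2 / 16 := min_le_left _ _
  have hδ2 : δ ≤ 1 / 4 := min_le_right _ _
  refine ⟨δ, hδ0, ⌈1 / δ⌉₊ + 2, fun p₀ hp₀ P hP => ?_⟩
  have hp2 : 2 ≤ p₀ := by omega
  have hp2' : (2 : ℝ) ≤ p₀ := by exact_mod_cast hp2
  have hδp : 1 ≤ δ * p₀ := by
    have h1 : (1 / δ : ℝ) ≤ p₀ := (Nat.le_ceil _).trans (by exact_mod_cast (by omega))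
    rwa [div_le_iff₀ hδ0, mul_comm] at h1
  have h4 : (4 : ℝ) ≤ p₀ := by nlinarith
  obtain ⟨x, rfl⟩ : ∃ x, p₀ = x + 1 := ⟨p₀ - 1, by omega⟩
  set h := ⌊δ * ((x + 1 : ℕ) : ℝ)⌋₊ + 1 with hhdef
  have hh0 : 0 < h := by omega
  have hh0' : (0 : ℝ) < h := by exact_mod_cast hh0
  have hhle : (h : ℝ) ≤ 2 * (δ * ((x + 1 : ℕ) : ℝ)) := by
    rw [hhdef]
    push_cast
    have := Nat.floor_le (by positivity : 0 ≤ δ * ((x + 1 : ℕ) : ℝ))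
    push_cast at this hδp
    linarith
  have hhx : h ≤ x := by
    have : (h : ℝ) ≤ x := by
      push_cast at hhle h4
      nlinarith
    exact_mod_cast this
  have hsub : P ⊆ (Ioc x (x + h)).filter Nat.Prime := by
    intro p hp
    obtain ⟨h1, h2, h3⟩ := hP p hp
    simp only [mem_filter, mem_Ioc]
    refine ⟨⟨by omega, ?_⟩, h1⟩
    have h5 : ((p - (x + 1) : ℕ) : ℝ) ≤ δ * ((x + 1 : ℕ) : ℝ) := by
      rw [Nat.cast_sub h2]
      linarith
    have := Nat.le_floor h5
    omega
  have hcard := card_primes_mul_log_le hh0 hhx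
  have hlog : 0 < Real.log ((x + 1 : ℕ) : ℝ) := Real.log_pos (by linarith)
  have hx0 : (0 : ℝ) < ((x + 1 : ℕ) : ℝ) := by positivity
  have hbound : (h : ℝ) * (1 + Real.log ((x + h : ℕ) / h)) ≤ ε * ((x + 1 : ℕ) : ℝ) := by
    set t : ℝ := ((x + h : ℕ) : ℝ) / h with ht
    have ht0 : 0 < t := by positivity
    have hl : Real.log t ≤ 2 * (√t - 1) := by
      have := Real.log_le_sub_one_of_pos (Real.sqrt_pos.2 ht0)
      rw [Real.log_sqrt ht0.le] at this
      linarith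
    have hsq : (h * √t) ^ 2 ≤ (ε / 2 * ((x + 1 : ℕ) : ℝ)) ^ 2 := by
      rw [mul_pow, Real.sq_sqrt ht0.le, ht]
      have e1 : (h : ℝ) ^ 2 * (((x + h : ℕ) : ℝ) / h) = h * ((x + h : ℕ) : ℝ) := by
        field_simp
      rw [e1]
      have e2 : ((x + h : ℕ) : ℝ) ≤ 2 * ((x + 1 : ℕ) : ℝ) := by
        exact_mod_cast (by omega : x + h ≤ 2 * (x + 1))
      calc (h : ℝ) * ((x + h : ℕ) : ℝ)
          ≤ (2 * (δ * ((x + 1 : ℕ) : ℝ))) * (2 * ((x + 1 : ℕ) : ℝ)) := by gcongr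
        _ = 4 * δ * ((x + 1 : ℕ) : ℝ) ^ 2 := by ring
        _ ≤ 4 * (ε ^ 2 / 16) * ((x + 1 : ℕ) : ℝ) ^ 2 := by gcongr
        _ = _ := by ring
    have hle : h * √t ≤ ε / 2 * ((x + 1 : ℕ) : ℝ) :=
      abs_le_of_sq_le_sq' hsq (by positivity) |>.2
    nlinarith
  calc ∑ p ∈ P, (1 : ℝ) / p
      ≤ ∑ p ∈ P, (1 : ℝ) / ((x + 1 : ℕ) : ℝ) := by
        refine Finset.sum_le_sum fun p hp => ?_
        exact one_div_le_one_div_of_le hx0 (by exact_mod_cast (hP p hp).2.1)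
    _ = #P / ((x + 1 : ℕ) : ℝ) := by
        rw [Finset.sum_const, nsmul_eq_mul, mul_one_div]
    _ ≤ ε / Real.log ((x + 1 : ℕ) : ℝ) := by
        rw [div_le_div_iff₀ hx0 hlog]
        refine le_trans ?_ hbound
        refine le_trans ?_ hcard
        push_cast
        refine mul_le_mul_of_nonneg_right ?_ (by push_cast at hlog; exact hlog.le)
        exact_mod_cast Finset.card_le_card hsub

/-! ### Primes outside a set with convergent sum of reciprocals. -/

/-- The primes in `(4 ^ j, 4 ^ (j + 1)]`. -/
def primeWindow (j : ℕ) : Finset ℕ := {p ∈ Ioc (4 ^ j) (4 ^ (j + 1)) | p.Prime}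

lemma mem_primeWindow {j p : ℕ} :
    p ∈ primeWindow j ↔ (4 ^ j < p ∧ p ≤ 4 ^ (j + 1)) ∧ p.Prime := by
  simp [primeWindow]

/-- Chebyshev's constants are `log 2` below and `log 4` above, so a window of ratio 4 retains a
positive proportion of `θ`. -/
lemma exists_sum_primeWindow_ge :
    ∃ j₀ : ℕ, ∀ j, j₀ ≤ j → 1 / (8 * ((j : ℝ) + 1)) ≤ ∑ p ∈ primeWindow j, (1 : ℝ) / p := by
  have hlog2 : 0 < Real.log 2 := Real.log_pos one_lt_two
  have hlog4 : Real.log 4 = 2 * Real.log 2 := by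
    rw [show (4 : ℝ) = 2 ^ 2 by norm_num, Real.log_pow]
    norm_num
  -- The constant `log 2 / 16` turns the error `4√n log n` into at most a quarter of `n log 2`.
  have ho := (isLittleO_log_rpow_atTop (r := 1 / 2) (by norm_num)).bound
    (c := Real.log 2 / 16) (by positivity)
  have ho' := (tendsto_pow_atTop_atTop_of_one_lt (r := (4 : ℝ)) (by norm_num)).eventually ho
  obtain ⟨j₀, hj₀⟩ := eventually_atTop.1 ho'
  refine ⟨j₀, fun j hj => ?_⟩
  have h1 := hj₀ (j + 1) (by omega)
  set n : ℕ := 4 ^ (j + 1) with hn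
  have hn4 : 4 ≤ n := by
    rw [hn, pow_succ]
    have : 0 < 4 ^ j := by positivity
    omega
  have hn4' : (4 : ℝ) ≤ n := by exact_mod_cast hn4
  have hlogn : 0 ≤ Real.log n := Real.log_nonneg (by linarith)
  have hnr : (4 : ℝ) ^ (j + 1) = n := by simp [hn]
  rw [hnr, ← Real.sqrt_eq_rpow, Real.norm_of_nonneg hlogn,
    Real.norm_of_nonneg (Real.sqrt_nonneg _)] at h1
  have hlow := Chebyshev.theta_ge n
  have hlogn1 : Real.log (n + 1) ≤ 2 * Real.log n := by
    rw [← Real.log_rpow (by linarith)]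
    refine Real.log_le_log (by positivity) ?_
    norm_num
    nlinarith
  have hsq : √(n : ℝ) * √n = n := Real.mul_self_sqrt (by linarith)
  have hs1 : 1 ≤ √(n : ℝ) := Real.one_le_sqrt.2 (by linarith)
  have hlow' : (n : ℝ) * Real.log 2 - n * Real.log 2 / 4 ≤ Chebyshev.theta n := by
    have e1 : Real.log (n + 1) + 2 * √n * Real.log n ≤ 4 * √n * Real.log n := by
      nlinarith
    have e2 : 4 * √n * Real.log n ≤ 4 * √n * (Real.log 2 / 16 * √n) := by gcongr
    have e3 : 4 * √n * (Real.log 2 / 16 * √n) = n * Real.log 2 / 4 := by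
      rw [show 4 * √(n : ℝ) * (Real.log 2 / 16 * √n) = (√n * √n) * Real.log 2 / 4 by ring, hsq]
    linarith
  have hup := Chebyshev.theta_le_log4_mul_x (x := ((4 ^ j : ℕ) : ℝ)) (by positivity)
  have hnj : (n : ℝ) = 4 * ((4 ^ j : ℕ) : ℝ) := by
    rw [hn, pow_succ]
    push_cast
    ring
  have hdiff : Chebyshev.theta n - Chebyshev.theta ((4 ^ j : ℕ) : ℝ) =
      ∑ p ∈ primeWindow j, Real.log p := by
    unfold Chebyshev.theta primeWindow
    rw [Nat.floor_natCast, Nat.floor_natCast, Finset.sum_filter, Finset.sum_filter,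
      Finset.sum_filter, ← Finset.sum_Ioc_consecutive _ (Nat.zero_le (4 ^ j))
      (Nat.pow_le_pow_right (by norm_num) (Nat.le_succ j))]
    exact add_sub_cancel_left _ _
  have hsum : (n : ℝ) * Real.log 2 / 4 ≤ ∑ p ∈ primeWindow j, Real.log p := by
    rw [← hdiff]
    rw [hlog4] at hup
    nlinarith
  have hlogpos : 0 < Real.log n := Real.log_pos (by linarith)
  have hpt : ∀ p ∈ primeWindow j, Real.log p / (n * Real.log n) ≤ (1 : ℝ) / p := by
    intro p hp
    rw [mem_primeWindow] at hp
    have hp0 : (0 : ℝ) < p := by exact_mod_cast hp.2.pos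
    have hpn : (p : ℝ) ≤ n := by exact_mod_cast hp.1.2
    rw [div_le_div_iff₀ (by positivity) hp0, one_mul, mul_comm]
    exact mul_le_mul hpn (Real.log_le_log hp0 hpn)
      (Real.log_nonneg (by exact_mod_cast hp.2.one_le)) (by positivity)
  have hlogn' : Real.log n = (j + 1) * (2 * Real.log 2) := by
    rw [← hnr, Real.log_pow, hlog4]
    push_cast
    ring
  refine le_trans ?_ (Finset.sum_le_sum hpt)
  rw [← Finset.sum_div, le_div_iff₀ (by positivity), hlogn']
  refine le_trans (le_of_eq ?_) hsum
  field_simp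
  ring

lemma summable_sum_primeWindow {f : ℕ → ℝ} (hf : Summable f) (h0 : ∀ n, 0 ≤ f n) :
    Summable fun j => ∑ p ∈ primeWindow j, f p := by
  refine summable_of_sum_range_le (c := ∑' n, f n)
    (fun j => Finset.sum_nonneg fun p _ => h0 p) fun n => ?_
  have h : ∑ j ∈ range n, ∑ p ∈ primeWindow j, f p = ∑ p ∈ Ioc 1 (4 ^ n) with p.Prime, f p := by
    induction n with
    | zero => simp
    | succ n ih =>
      rw [Finset.sum_range_succ, ih, primeWindow, Finset.sum_filter, Finset.sum_filter,
        Finset.sum_filter, Finset.sum_Ioc_consecutive _ (Nat.one_le_pow _ _ (by norm_num))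
        (Nat.pow_le_pow_right (by norm_num) (Nat.le_succ n))]
  rw [h]
  exact hf.sum_le_tsum _ fun n _ => h0 n

/-- A set of natural numbers with convergent sum of reciprocals. -/
def SmallReciprocals (B : Set ℕ) : Prop := Summable (B.indicator fun p : ℕ => (1 : ℝ) / p)

/-- If every `j ≥ j₀` failed, the window masses of `B` at `j` and `j + i` would dominate a harmonic
series, while their sum converges. -/
lemma exists_scale_of_smallReciprocals {B : Set ℕ} (hB : SmallReciprocals B) {η : ℝ} (hη : 0 < η)
    (i j₀ : ℕ) : ∃ j, j₀ ≤ j ∧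
      ∑ p ∈ primeWindow j, B.indicator (fun p : ℕ => (1 : ℝ) / p) p < η / (j + 1) ∧
      ∑ p ∈ primeWindow (j + i), B.indicator (fun p : ℕ => (1 : ℝ) / p) p <
        η / ((j + i : ℕ) + 1) := by
  have h0 : ∀ p, 0 ≤ B.indicator (fun p : ℕ => (1 : ℝ) / p) p := fun p =>
    Set.indicator_nonneg (fun _ _ => by positivity) p
  by_contra! hcon
  have hs := summable_sum_primeWindow hB h0
  set b : ℕ → ℝ := fun j => ∑ p ∈ primeWindow j, B.indicator (fun p : ℕ => (1 : ℝ) / p) p with hb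
  have hb0 : ∀ j, 0 ≤ b j := fun j => Finset.sum_nonneg fun p _ => h0 p
  have hs1 : Summable fun j => b (j + j₀) := (summable_nat_add_iff j₀).2 hs
  have hs2 : Summable fun j => b (j + (j₀ + i)) := (summable_nat_add_iff (j₀ + i)).2 hs
  have hle : ∀ j : ℕ, η * (1 / ((j + (j₀ + i + 1) : ℕ) : ℝ)) ≤ b (j + j₀) + b (j + (j₀ + i)) := by
    intro j
    rw [mul_one_div]
    by_cases h : b (j + j₀) < η / ((j + j₀ : ℕ) + 1)
    · have := hcon (j + j₀) (by omega) h
      have h2 : b (j + j₀ + i) = b (j + (j₀ + i)) := by rw [add_assoc]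
      rw [← h2]
      refine le_trans (le_trans (le_of_eq ?_) this) (le_add_of_nonneg_left (hb0 _))
      push_cast
      ring
    · refine le_trans (le_trans ?_ (not_lt.1 h)) (le_add_of_nonneg_right (hb0 _))
      refine div_le_div_of_nonneg_left hη.le (by positivity) ?_
      push_cast
      have : (0 : ℝ) ≤ i := by positivity
      linarith
  have hsum : Summable fun j : ℕ => η * (1 / ((j + (j₀ + i + 1) : ℕ) : ℝ)) :=
    Summable.of_nonneg_of_le (fun j => by positivity) hle (hs1.add hs2)
  rw [summable_mul_left_iff hη.ne'] at hsum
  exact Real.not_summable_one_div_natCast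
    ((summable_nat_add_iff (f := fun n : ℕ => 1 / (n : ℝ)) (j₀ + i + 1)).1 hsum)

lemma le_sum_primeWindow_diff {B : Set ℕ} [DecidablePred (· ∈ B)] {j : ℕ}
    (h1 : 1 / (8 * ((j : ℝ) + 1)) ≤ ∑ p ∈ primeWindow j, (1 : ℝ) / p)
    (h2 : ∑ p ∈ primeWindow j, B.indicator (fun p : ℕ => (1 : ℝ) / p) p < (1 / 16) / (j + 1)) :
    1 / (16 * ((j : ℝ) + 1)) < ∑ p ∈ primeWindow j with p ∉ B, (1 : ℝ) / p := by
  have h3 : ∑ p ∈ primeWindow j, (1 : ℝ) / p =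
      ∑ p ∈ primeWindow j, B.indicator (fun p : ℕ => (1 : ℝ) / p) p +
        ∑ p ∈ primeWindow j with p ∉ B, (1 : ℝ) / p := by
    rw [← Finset.sum_filter_add_sum_filter_not (primeWindow j) (· ∈ B)]
    congr 1
    rw [Finset.sum_filter]
    refine Finset.sum_congr rfl fun p _ => ?_
    simp [Set.indicator_apply]
  have h4 : 1 / (8 * ((j : ℝ) + 1)) = 1 / (16 * ((j : ℝ) + 1)) + (1 / 16) / (j + 1) := by
    field_simp
    ring
  linarith

/-- Outside a set with convergent sum of reciprocals, there are primes whose ratio is comparable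
to any given `r`. -/
lemma exists_primes_le_mul_le {B : Set ℕ} (hB : SmallReciprocals B) {r : ℕ} (hr : 4 ≤ r) :
    ∃ p q : ℕ, p.Prime ∧ q.Prime ∧ p ∉ B ∧ q ∉ B ∧ p ≤ r * q ∧ r * q ≤ 64 * p := by
  classical
  obtain ⟨j₀, hj₀⟩ := exists_sum_primeWindow_ge
  -- As `r` lies in `[4 ^ (i + 1), 4 ^ (i + 2))`, any `q` in window `j` and `p` in window `j + i`
  -- satisfy both inequalities.
  obtain ⟨i, hi⟩ : ∃ i, Nat.log 4 r = i + 1 :=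
    ⟨Nat.log 4 r - 1, by have := Nat.log_pos (b := 4) (by norm_num) hr; omega⟩
  have hir : 4 ^ (i + 1) ≤ r := hi ▸ Nat.pow_log_le_self 4 (by omega)
  have hri : r < 4 ^ (i + 2) := by
    have := Nat.lt_pow_succ_log_self (b := 4) (by norm_num) r
    rwa [hi] at this
  obtain ⟨j, hj, h1, h2⟩ :=
    exists_scale_of_smallReciprocals hB (η := 1 / 16) (by norm_num) i j₀
  have hex : ∀ k, j₀ ≤ k →
      ∑ p ∈ primeWindow k, B.indicator (fun p : ℕ => (1 : ℝ) / p) p < (1 / 16) / (k + 1) →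
      ∃ p, p ∈ primeWindow k ∧ p ∉ B := by
    intro k hk h
    have h3 := le_sum_primeWindow_diff (hj₀ k hk) h
    have h4 : 0 < ∑ p ∈ primeWindow k with p ∉ B, (1 : ℝ) / p := lt_trans (by positivity) h3
    obtain ⟨p, hp⟩ := Finset.nonempty_of_sum_ne_zero h4.ne'
    exact ⟨p, (mem_filter.1 hp).1, (mem_filter.1 hp).2⟩
  obtain ⟨q, hq, hqB⟩ := hex j hj h1
  obtain ⟨p, hp, hpB⟩ := hex (j + i) (by omega) h2
  rw [mem_primeWindow] at hp hq
  refine ⟨p, q, hp.2, hq.2, hpB, hqB, ?_, ?_⟩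
  · calc p ≤ 4 ^ (j + i + 1) := hp.1.2
      _ = 4 ^ (i + 1) * 4 ^ j := by ring
      _ ≤ r * q := Nat.mul_le_mul hir hq.1.1.le
  · calc r * q ≤ 4 ^ (i + 2) * 4 ^ (j + 1) := Nat.mul_le_mul hri.le hq.1.2
      _ = 64 * 4 ^ (j + i) := by ring
      _ ≤ 64 * p := Nat.mul_le_mul_left _ hp.1.1.le

/-- Outside a set with convergent sum of reciprocals, there are pairs of primes that are close,
but not too close, to each other. -/
lemma exists_close_primes {ε : ℝ} (hε : 0 < ε) :
    ∃ δ : ℝ, 0 < δ ∧ ∀ B : Set ℕ, SmallReciprocals B →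
      ∃ p q : ℕ, p.Prime ∧ q.Prime ∧ p ∉ B ∧ q ∉ B ∧ (1 + δ) * p < q ∧ (q : ℝ) < (1 + ε) * p := by
  classical
  set n : ℕ := ⌊4 / ε⌋₊ + 1 with hn
  have hn0 : (0 : ℝ) < n := by positivity
  obtain ⟨δ, hδ, x₀, hx₀⟩ := exists_short_interval_prime_bound (ε := 1 / (64 * n)) (by positivity)
  refine ⟨δ, hδ, fun B hB => ?_⟩
  obtain ⟨j₀, hj₀⟩ := exists_sum_primeWindow_ge
  obtain ⟨j, hj, h1, -⟩ := exists_scale_of_smallReciprocals hB (η := 1 / 16) (by norm_num) 0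
    (max j₀ (x₀ + 1))
  have hjj : j₀ ≤ j := (le_max_left _ _).trans hj
  have hjx : x₀ + 1 ≤ j := (le_max_right _ _).trans hj
  have hmass := le_sum_primeWindow_diff (hj₀ j hjj) h1
  set W := (primeWindow j).filter (· ∉ B) with hW
  have h4j : (0 : ℝ) < 4 ^ j := by positivity
  -- The window is cut into `n` cells of width `ε * 4 ^ j`. Two primes in one cell have ratio below
  -- `1 + ε`, and some cell has at least the average mass.
  set f : ℕ → ℕ := fun p => ⌊(p : ℝ) / 4 ^ j / ε⌋₊ with hf
  have hmaps : ∀ p ∈ W, f p ∈ range n := by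
    intro p hp
    have hp' := (mem_primeWindow.1 (mem_filter.1 hp).1).1.2
    rw [mem_range, hn, hf]
    refine Nat.lt_succ_of_le (Nat.floor_le_floor ?_)
    gcongr
    rw [div_le_iff₀ h4j]
    calc (p : ℝ) ≤ ((4 ^ (j + 1) : ℕ) : ℝ) := by exact_mod_cast hp'
      _ = 4 * 4 ^ j := by push_cast; ring
  obtain ⟨i, -, hi⟩ : ∃ i ∈ range n, 1 / (16 * ((j : ℝ) + 1)) / n ≤
      ∑ p ∈ W with f p = i, (1 : ℝ) / p := by
    refine Finset.exists_le_of_sum_le ⟨0, by simp [hn]⟩ ?_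
    rw [Finset.sum_fiberwise_of_maps_to hmaps]
    simp only [Finset.sum_const, card_range, nsmul_eq_mul]
    rw [mul_div_cancel₀ _ hn0.ne']
    exact hmass.le
  set V := W.filter (fun p => f p = i) with hV
  have hpos : 0 < ∑ p ∈ V, (1 : ℝ) / p := lt_of_lt_of_le (by positivity) hi
  have hVne : V.Nonempty := Finset.nonempty_of_sum_ne_zero hpos.ne'
  have hVmem : ∀ p ∈ V, p.Prime ∧ p ∉ B ∧ 4 ^ j < p ∧ f p = i := by
    intro p hp
    rw [hV, mem_filter, hW, mem_filter, mem_primeWindow] at hp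
    exact ⟨hp.1.1.2, hp.1.2, hp.1.1.1.1, hp.2⟩
  set p₀ := V.min' hVne with hp₀
  have hp₀V : p₀ ∈ V := V.min'_mem hVne
  obtain ⟨hp₀p, hp₀B, hp₀j, hp₀f⟩ := hVmem p₀ hp₀V
  by_contra! hcon
  have hj4 : j < 4 ^ j := Nat.lt_pow_self (by norm_num)
  -- Without a pair of ratio above `1 + δ`, the whole cell lies in `[p₀, (1 + δ) * p₀]`, which is
  -- too short to carry its mass.
  have hshort := hx₀ p₀ (by omega) V fun p hp => by
    obtain ⟨hpp, hpB, hpj, hpf⟩ := hVmem p hp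
    refine ⟨hpp, V.min'_le p hp, ?_⟩
    by_contra! hlt
    refine absurd (hcon p₀ p hp₀p hpp hp₀B hpB hlt) (not_le.2 ?_)
    have e1 : (p : ℝ) / 4 ^ j / ε < f p + 1 := Nat.lt_floor_add_one _
    have e2 : (f p₀ : ℝ) ≤ (p₀ : ℝ) / 4 ^ j / ε := Nat.floor_le (by positivity)
    rw [hpf] at e1
    rw [hp₀f] at e2
    have e3 : (p : ℝ) / 4 ^ j / ε < (p₀ : ℝ) / 4 ^ j / ε + 1 := by linarith
    have e4 : (p : ℝ) < p₀ + ε * 4 ^ j := by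
      rw [div_div, div_div, div_add_one (by positivity), div_lt_div_iff_of_pos_right (by positivity)]
        at e3
      linarith
    have e5 : ((4 ^ j : ℕ) : ℝ) ≤ p₀ := by exact_mod_cast hp₀j.le
    push_cast at e5
    nlinarith
  have hlog : (j : ℝ) + 1 ≤ 2 * Real.log p₀ := by
    have e1 : Real.log ((4 : ℝ) ^ j) ≤ Real.log p₀ :=
      Real.log_le_log h4j (by exact_mod_cast hp₀j.le)
    have e2 : (1 : ℝ) ≤ Real.log 4 := by
      rw [Real.le_log_iff_exp_le (by norm_num)]
      linarith [Real.exp_one_lt_d9]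
    rw [Real.log_pow] at e1
    have e3 : (1 : ℝ) ≤ j := by exact_mod_cast (by omega : 1 ≤ j)
    nlinarith
  have hlog0 : 0 < Real.log p₀ := by
    have : (0 : ℝ) ≤ j := by positivity
    linarith
  have hfin := hi.trans hshort
  rw [div_div, div_div, div_le_div_iff₀ (by positivity) (by positivity)] at hfin
  nlinarith [mul_pos hn0 hlog0]


/-! ### Comparing products of different numbers of primes; shift invariance. -/

lemma SmallReciprocals.union {A B : Set ℕ} (hA : SmallReciprocals A) (hB : SmallReciprocals B) :
    SmallReciprocals (A ∪ B) := by
  refine Summable.of_nonneg_of_le (fun p => Set.indicator_nonneg (fun _ _ => by positivity) p)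
    (fun p => ?_) (hA.add hB)
  have h0 : (0 : ℝ) ≤ 1 / p := by positivity
  by_cases h1 : p ∈ A <;> by_cases h2 : p ∈ B <;> simp [h1, h2]

lemma SmallReciprocals.of_finite {A : Set ℕ} (hA : A.Finite) : SmallReciprocals A :=
  summable_of_hasFiniteSupport (hA.subset Set.support_indicator_subset)

lemma SmallReciprocals.biUnion {ι : Type*} (s : Finset ι) {A : ι → Set ℕ}
    (hA : ∀ i ∈ s, SmallReciprocals (A i)) : SmallReciprocals (⋃ i ∈ s, A i) := by
  classical
  induction s using Finset.induction_on with
  | empty => simpa using SmallReciprocals.of_finite Set.finite_empty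
  | insert i s _ ih =>
    rw [Finset.set_biUnion_insert]
    exact (hA i (mem_insert_self i s)).union (ih fun j hj => hA j (mem_insert_of_mem hj))

/-- The primes `p` for which `g (k + 1) (m * p)` is far from `g k m`. -/
def farPrimes (g : ℕ → ℕ → ℝ) (η : ℝ) (k m : ℕ) : Set ℕ :=
  {p | p.Prime ∧ η < |g (k + 1) (m * p) - g k m|}

/-- Turán–Kubilius property of a doubly indexed family. -/
def IsPrimeStable (g : ℕ → ℕ → ℝ) : Prop :=
  ∀ k m, 0 < m → ∀ P : Finset ℕ, (∀ p ∈ P, p.Prime) →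
    ∑ p ∈ P, 1 / (p : ℝ) * |g (k + 1) (m * p) - g k m| ≤ √(∑ p ∈ P, (1 : ℝ) / p)

/-- For a finite set of far primes with reciprocal sum `L`, stability gives `η * L ≤ √L`, hence `L ≤
1 / η ^ 2` uniformly. -/
lemma IsPrimeStable.smallReciprocals_farPrimes {g : ℕ → ℕ → ℝ} (hg : IsPrimeStable g) {η : ℝ}
    (hη : 0 < η) (k : ℕ) {m : ℕ} (hm : 0 < m) : SmallReciprocals (farPrimes g η k m) := by
  classical
  refine summable_of_sum_le (c := 1 / η ^ 2)
    (fun p => Set.indicator_nonneg (fun _ _ => by positivity) p) fun P => ?_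
  have h1 : ∑ p ∈ P, (farPrimes g η k m).indicator (fun p : ℕ => (1 : ℝ) / p) p =
      ∑ p ∈ P with p ∈ farPrimes g η k m, (1 : ℝ) / p := by
    rw [Finset.sum_filter]
    exact Finset.sum_congr rfl fun p _ => Set.indicator_apply _ _ _
  rw [h1]
  set V := P.filter (· ∈ farPrimes g η k m)
  have hV : ∀ p ∈ V, p ∈ farPrimes g η k m := fun p hp => (mem_filter.1 hp).2
  have h2 := hg k m hm V fun p hp => (hV p hp).1
  set L := ∑ p ∈ V, (1 : ℝ) / p
  have hL : 0 ≤ L := Finset.sum_nonneg fun _ _ => by positivity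
  have h3 : η * L ≤ √L := by
    refine le_trans ?_ h2
    rw [Finset.mul_sum]
    refine Finset.sum_le_sum fun p hp => ?_
    rw [mul_comm]
    exact mul_le_mul_of_nonneg_left (hV p hp).2.le (by positivity)
  have h4 : (η * L) ^ 2 ≤ L := by
    calc (η * L) ^ 2 ≤ √L ^ 2 := by gcongr
      _ = L := Real.sq_sqrt hL
  rw [le_div_iff₀ (by positivity)]
  rcases hL.eq_or_lt with h | h
  · rw [← h]; simp
  · by_contra! hc
    nlinarith [mul_pos h (sub_pos.2 hc)]

/-- `g K m` approximates `g 0 1`, and `g (K + 1) m` approximates `g 1 1`. -/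
def ApproxAt (g : ℕ → ℕ → ℝ) (K m : ℕ) (e : ℝ) : Prop :=
  |g K m - g 0 1| ≤ e ∧ |g (K + 1) m - g 1 1| ≤ e

lemma ApproxAt.step {g : ℕ → ℕ → ℝ} {K m : ℕ} {e η : ℝ} (h : ApproxAt g K m e) {p : ℕ}
    (hp : p.Prime) (hpB : p ∉ farPrimes g η K m ∪ farPrimes g η (K + 1) m) :
    ApproxAt g (K + 1) (m * p) (e + η) := by
  simp only [Set.mem_union, not_or, farPrimes, Set.mem_ofPred_eq, not_and, not_lt] at hpB
  have h1 := hpB.1 hp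
  have h2 := hpB.2 hp
  constructor
  · calc _ ≤ |g (K + 1) (m * p) - g K m| + |g K m - g 0 1| := abs_sub_le _ _ _
      _ ≤ _ := by linarith [h.1]
  · calc _ ≤ |g (K + 1 + 1) (m * p) - g (K + 1) m| + |g (K + 1) m - g 1 1| := abs_sub_le _ _ _
      _ ≤ _ := by linarith [h.2]

lemma IsPrimeStable.smallReciprocals_union {g : ℕ → ℕ → ℝ} (hg : IsPrimeStable g) {η : ℝ}
    (hη : 0 < η) (k : ℕ) {m : ℕ} (hm : 0 < m) :
    SmallReciprocals (farPrimes g η k m ∪ farPrimes g η (k + 1) m) :=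
  (hg.smallReciprocals_farPrimes hη k hm).union (hg.smallReciprocals_farPrimes hη (k + 1) hm)

/-- Each rung is a product of `M` primes. Induction multiplies all rungs by `p` and adds a new top
rung, the old top times `q`, with `p` and `q` close and outside the exceptional sets of all rungs.
-/
lemma IsPrimeStable.exists_ladder {g : ℕ → ℕ → ℝ} (hg : IsPrimeStable g) {η ε δ : ℝ} (hη : 0 < η)
    (hδ : ∀ B : Set ℕ, SmallReciprocals B → ∃ p q : ℕ, p.Prime ∧ q.Prime ∧ p ∉ B ∧ q ∉ B ∧
      (1 + δ) * p < q ∧ (q : ℝ) < (1 + ε) * p) (M : ℕ) :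
    ∃ h : ℕ → ℕ, (∀ i ≤ M, 0 < h i ∧ ApproxAt g M (h i) (M * η)) ∧
      ∀ i < M, (1 + δ) * h i ≤ h (i + 1) ∧ (h (i + 1) : ℝ) ≤ (1 + ε) * h i := by
  induction M with
  | zero =>
    refine ⟨fun _ => 1, fun i _ => ⟨one_pos, ?_⟩, fun i hi => absurd hi (Nat.not_lt_zero i)⟩
    simp [ApproxAt]
  | succ M ih =>
    obtain ⟨h, h1, h2⟩ := ih
    obtain ⟨p, q, hp, hq, hpB, hqB, hpq, hqp⟩ :=
      hδ (⋃ i ∈ range (M + 1), farPrimes g η M (h i) ∪ farPrimes g η (M + 1) (h i))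
      (SmallReciprocals.biUnion _ fun i hi =>
        hg.smallReciprocals_union hη M (h1 i (Nat.lt_succ_iff.1 (mem_range.1 hi))).1)
    simp only [Set.mem_iUnion, not_exists, mem_range] at hpB hqB
    have hcast : ((M + 1 : ℕ) : ℝ) * η = M * η + η := by push_cast; ring
    refine ⟨fun i => if i ≤ M then h i * p else h M * q, fun i hi => ?_, fun i hi => ?_⟩
    · rw [hcast]
      beta_reduce
      split_ifs with hiM
      · exact ⟨Nat.mul_pos (h1 i hiM).1 hp.pos, (h1 i hiM).2.step hp (hpB i (by omega))⟩
      · exact ⟨Nat.mul_pos (h1 M le_rfl).1 hq.pos, (h1 M le_rfl).2.step hq (hqB M (by omega))⟩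
    · have hp0 : (0 : ℝ) < p := by exact_mod_cast hp.pos
      beta_reduce
      rcases Nat.lt_succ_iff_lt_or_eq.1 hi with hiM | rfl
      · rw [if_pos hiM.le, if_pos (Nat.succ_le_of_lt hiM)]
        obtain ⟨h3, h4⟩ := h2 i hiM
        push_cast
        constructor <;> nlinarith
      · rw [if_pos le_rfl, if_neg (by omega)]
        have h3 : (0 : ℝ) < h i := by exact_mod_cast (h1 i le_rfl).1
        push_cast
        constructor <;> nlinarith

lemma exists_ladder_step {h : ℕ → ℝ} {c T : ℝ} {M : ℕ} (h0 : h 0 ≤ T) (hT : T ≤ h M)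
    (hc : ∀ i < M, h (i + 1) ≤ c * h i) (hM : ∀ i ≤ M, h i ≤ c * h i) :
    ∃ i ≤ M, h i ≤ T ∧ T ≤ c * h i := by
  induction M with
  | zero => exact ⟨0, le_rfl, h0, hT.trans (hM 0 le_rfl)⟩
  | succ M ih =>
    by_cases hlt : h M ≤ T
    · exact ⟨M, M.le_succ, hlt, hT.trans (hc M M.lt_succ_self)⟩
    · obtain ⟨i, hi, h6⟩ :=
        ih (not_le.1 hlt).le (fun i hi => hc i (by omega)) fun i hi => hM i (by omega)
      exact ⟨i, by omega, h6⟩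

/-- Some `h i * p`, with `M + 1` prime factors, lies within a factor `1 + ε` of `T = h 0 * q₁ * q`,
with `M + 2`. At level `M + 2` the former remembers `g 1 1` and the latter `g 0 1`. -/
theorem IsPrimeStable.eq_shift {g : ℕ → ℕ → ℝ} (hg : IsPrimeStable g)
    (hlip : ∀ k m m', 0 < m → m ≤ m' → |g k m - g k m'| ≤ 2 * (1 - (m : ℝ) / m')) :
    g 0 1 = g 1 1 := by
  refine eq_of_forall_dist_le fun ε' hε' => ?_
  set ε := ε' / 3 with hεdef
  have hε : 0 < ε := by positivity
  obtain ⟨δ, hδ, hclose⟩ := exists_close_primes hε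
  -- 64 is the loss in `exists_primes_le_mul_le`; the ladder must span it.
  obtain ⟨M, hM⟩ := pow_unbounded_of_one_lt (64 : ℝ) (by linarith : 1 < 1 + δ)
  -- `M + 1` steps lead to `h i * p` and `M + 2` to `T`, so the stability errors total `ε`; the
  -- Lipschitz bound adds `2 * ε`.
  set η := ε / (2 * M + 3) with hηdef
  have hη : 0 < η := by positivity
  obtain ⟨h, h1, h2⟩ := hg.exists_ladder hη hclose M
  obtain ⟨hh0, happ0⟩ := h1 0 (Nat.zero_le M)
  obtain ⟨q₁, -, hq₁, -, hq₁B, -, -⟩ := exists_primes_le_mul_le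
    ((hg.smallReciprocals_union hη M hh0).union (SmallReciprocals.of_finite (Set.finite_Iio 4)))
    le_rfl
  rw [Set.mem_union, not_or, Set.mem_Iio, not_lt] at hq₁B
  have happ1 := happ0.step hq₁ hq₁B.1
  have hpos1 : 0 < h 0 * q₁ := Nat.mul_pos hh0 hq₁.pos
  obtain ⟨p, q, hp, hq, hpB, hqB, hpq, hqp⟩ := exists_primes_le_mul_le
    ((SmallReciprocals.biUnion (range (M + 1)) fun i hi =>
      hg.smallReciprocals_union hη M (h1 i (Nat.lt_succ_iff.1 (mem_range.1 hi))).1).union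
      (hg.smallReciprocals_union hη (M + 1) hpos1)) hq₁B.2
  rw [Set.mem_union, not_or] at hpB hqB
  have happT := happ1.step hq hqB.2
  set T := h 0 * q₁ * q with hT
  have hp0 : (0 : ℝ) < p := by exact_mod_cast hp.pos
  have hh0' : (0 : ℝ) < h 0 := by exact_mod_cast hh0
  have hgrow : ∀ i ≤ M, (1 + δ) ^ i * h 0 ≤ h i := by
    intro i hi
    induction i with
    | zero => simp
    | succ i ih =>
      refine le_trans ?_ (h2 i (by omega)).1
      rw [pow_succ', mul_assoc]
      exact mul_le_mul_of_nonneg_left (ih (by omega)) (by linarith)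
  have hpq' : (p : ℝ) ≤ q₁ * q := by exact_mod_cast hpq
  have hqp' : (q₁ : ℝ) * q ≤ 64 * p := by exact_mod_cast hqp
  have hTR : (T : ℝ) = h 0 * (q₁ * q) := by
    rw [hT]
    push_cast
    ring
  obtain ⟨i, hiM, hi1, hi2⟩ := exists_ladder_step (h := fun i => (h i : ℝ) * p) (c := 1 + ε)
    (T := T) (M := M)
    (by rw [hTR]; exact mul_le_mul_of_nonneg_left hpq' hh0'.le)
    (by
      rw [hTR]
      calc (h 0 : ℝ) * (q₁ * q) ≤ h 0 * (64 * p) := by gcongr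
        _ = 64 * h 0 * p := by ring
        _ ≤ (1 + δ) ^ M * h 0 * p := by gcongr
        _ ≤ h M * p := by gcongr; exact hgrow M le_rfl)
    (fun i hi => by nlinarith [(h2 i hi).2])
    (fun i _ => le_mul_of_one_le_left (by positivity) (by linarith))
  obtain ⟨hipos, hiapp⟩ := h1 i hiM
  simp only [Set.mem_iUnion, not_exists, mem_range] at hpB
  have happP := hiapp.step hp (hpB.1 i (by omega))
  have hle : h i * p ≤ T := by exact_mod_cast hi1
  have hl := hlip (M + 1 + 1) (h i * p) T (Nat.mul_pos hipos hp.pos) hle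
  have hT0 : (0 : ℝ) < T := by
    have : 0 < T := Nat.mul_pos hpos1 hq.pos
    exact_mod_cast this
  have hratio : 2 * (1 - ((h i * p : ℕ) : ℝ) / T) ≤ 2 * ε := by
    have : 1 - ε ≤ ((h i * p : ℕ) : ℝ) / T := by
      rw [le_div_iff₀ hT0]
      push_cast
      nlinarith
    linarith
  have hη' : (2 * M + 3) * η = ε := by
    rw [hηdef]
    field_simp
  have e1 := abs_le.1 happP.2
  have e2 := abs_le.1 happT.1
  have e3 := abs_le.1 (hl.trans hratio)
  rw [Real.dist_eq, abs_le]
  constructor <;> linarith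

/-- The distribution of `Ω n` on `n ≤ N` is asymptotically invariant under shifts. -/
theorem tendsto_mean_shift_cardFactors {a : ℕ → ℝ} (ha : ∀ k, |a k| ≤ 1) :
    Tendsto (fun N : ℕ => (∑ n ∈ Icc 1 N, (a (cardFactors n + 1) -
      a (cardFactors n))) / (N : ℝ)) atTop (𝓝 0) := by
  rw [tendsto_iff_ultrafilter]
  intro U hU
  obtain ⟨g, hg, hstable, hlip⟩ := exists_ultrafilter_limits ha U hU
  have h := (hg 1 1).sub (hg 0 1)
  rw [IsPrimeStable.eq_shift hstable hlip, sub_self] at h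
  refine h.congr fun N => ?_
  have hI : Ioc 0 N = Icc 1 N := rfl
  simp only [cardFactorsMean, Nat.div_one, hI, add_zero, Finset.sum_sub_distrib]
  push_cast
  ring


/-! ### Uniform means and van der Corput differencing. -/

/-- The averages of `a` over intervals tend to zero, uniformly in the position of the interval. -/
def UniformlyNullMean (a : ℕ → ℂ) : Prop :=
  ∀ ε : ℝ, 0 < ε → ∃ H₀ : ℕ, ∀ H, H₀ ≤ H → ∀ m, ‖∑ h ∈ range H, a (m + h)‖ ≤ ε * H

lemma sum_range_shift_sub (b : ℕ → ℂ) (H q : ℕ) :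
    ∑ h ∈ range H, b (h + q) - ∑ h ∈ range H, b h =
      ∑ h ∈ range q, b (H + h) - ∑ h ∈ range q, b h := by
  have h1 := Finset.sum_range_add b H q
  have h2 := Finset.sum_range_add b q H
  rw [add_comm q H] at h2
  simp only [add_comm q] at h2
  linear_combination h1 - h2

lemma norm_sum_range_shift_sub_le {b : ℕ → ℂ} (hb : ∀ n, ‖b n‖ ≤ 1) (H q : ℕ) :
    ‖∑ h ∈ range H, b (h + q) - ∑ h ∈ range H, b h‖ ≤ 2 * q := by
  rw [sum_range_shift_sub]
  refine (norm_sub_le _ _).trans ?_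
  have h : ∀ f : ℕ → ℕ, ‖∑ h ∈ range q, b (f h)‖ ≤ q := fun f =>
    (norm_sum_le_of_le _ fun h _ => hb (f h)).trans (by simp)
  have h1 := h fun h => H + h
  have h2 := h fun h => h
  linarith

/-- Shifting by `q` multiplies the sum by `z` but alters only `2 * q` boundary terms, so `(z - 1)`
times the sum is bounded. -/
lemma uniformlyNullMean_of_quasiperiodic {a : ℕ → ℂ} (ha : ∀ n, ‖a n‖ ≤ 1) {q : ℕ} {z : ℂ}
    (hz : z ≠ 1) (haq : ∀ n, a (n + q) = z * a n) : UniformlyNullMean a := by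
  intro ε hε
  have hz' : 0 < ‖z - 1‖ := norm_pos_iff.2 (sub_ne_zero.2 hz)
  refine ⟨⌈2 * q / (ε * ‖z - 1‖)⌉₊, fun H hH m => ?_⟩
  have hH' : 2 * q / (ε * ‖z - 1‖) ≤ H := (Nat.le_ceil _).trans (by exact_mod_cast hH)
  have h1 := norm_sum_range_shift_sub_le (b := fun h => a (m + h)) (fun n => ha _) H q
  have h2 : ∑ h ∈ range H, a (m + (h + q)) - ∑ h ∈ range H, a (m + h) =
      (z - 1) * ∑ h ∈ range H, a (m + h) := by
    rw [sub_mul, one_mul, Finset.mul_sum]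
    congr 1
    exact Finset.sum_congr rfl fun h _ => by rw [← add_assoc, haq]
  rw [h2, norm_mul] at h1
  rw [div_le_iff₀ (by positivity)] at hH'
  refine le_of_mul_le_mul_left (h1.trans (hH'.trans (le_of_eq ?_))) hz'
  ring

lemma sum_norm_sq_sum_le (a : ℕ → ℂ) (D H m : ℕ) {C : ℝ}
    (hC : ∀ d < D, ∀ d' < D,
      ‖∑ h ∈ range H, a (m + h + d) * (starRingEnd ℂ) (a (m + h + d'))‖ ≤
        if d = d' then (H : ℝ) else C) (hC0 : 0 ≤ C) :
    ∑ h ∈ range H, ‖∑ d ∈ range D, a (m + h + d)‖ ^ 2 ≤ D * H + D ^ 2 * C := by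
  have h1 : ((∑ h ∈ range H, ‖∑ d ∈ range D, a (m + h + d)‖ ^ 2 : ℝ) : ℂ) =
      ∑ d ∈ range D, ∑ d' ∈ range D, ∑ h ∈ range H,
        a (m + h + d) * (starRingEnd ℂ) (a (m + h + d')) := by
    push_cast
    calc _ = ∑ h ∈ range H, ∑ d ∈ range D, ∑ d' ∈ range D,
          a (m + h + d) * (starRingEnd ℂ) (a (m + h + d')) := by
          refine Finset.sum_congr rfl fun h _ => ?_
          rw [← Complex.mul_conj', map_sum, Finset.sum_mul_sum]
      _ = _ := by
          rw [Finset.sum_comm]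
          exact Finset.sum_congr rfl fun d _ => Finset.sum_comm
  have h2 : ∑ h ∈ range H, ‖∑ d ∈ range D, a (m + h + d)‖ ^ 2 =
      ‖((∑ h ∈ range H, ‖∑ d ∈ range D, a (m + h + d)‖ ^ 2 : ℝ) : ℂ)‖ := by
    rw [Complex.norm_real, Real.norm_of_nonneg (Finset.sum_nonneg fun _ _ => sq_nonneg _)]
  rw [h2, h1]
  calc _ ≤ ∑ d ∈ range D, ∑ d' ∈ range D, ((if d = d' then (H : ℝ) else 0) + C) := by
        refine norm_sum_le_of_le _ fun d hd => norm_sum_le_of_le _ fun d' hd' => ?_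
        refine (hC d (mem_range.1 hd) d' (mem_range.1 hd')).trans ?_
        split_ifs
        · linarith
        · simp
    _ = _ := by
        simp only [Finset.sum_add_distrib, Finset.sum_ite_eq, Finset.sum_const, nsmul_eq_mul,
          card_range]
        rw [Finset.sum_congr rfl (g := fun _ => (H : ℝ)) fun d hd => if_pos hd]
        simp only [Finset.sum_const, nsmul_eq_mul, card_range]
        ring

/-- Van der Corput's difference theorem, uniform version. -/
theorem uniformlyNullMean_of_differences {a : ℕ → ℂ} (ha : ∀ n, ‖a n‖ ≤ 1)
    (hd : ∀ d, 0 < d → UniformlyNullMean fun n => a (n + d) * (starRingEnd ℂ) (a n)) :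
    UniformlyNullMean a := by
  intro ε hε
  -- Chosen so that the diagonal `D * H` is at most `D ^ 2 * (ε ^ 2 / 8) * H`, the off-diagonal
  -- bound.
  set D : ℕ := ⌈8 / ε ^ 2⌉₊ + 1 with hD
  have hD0 : (0 : ℝ) < D := by positivity
  have hD1 : 8 / ε ^ 2 ≤ D := (Nat.le_ceil _).trans (by rw [hD]; push_cast; linarith)
  have hD2 : 8 ≤ D * ε ^ 2 := by rwa [div_le_iff₀ (by positivity)] at hD1
  choose! H₁ hH₁ using fun d (h : 0 < d) => hd d h (ε ^ 2 / 8) (by positivity)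
  refine ⟨(range D).sup H₁ + ⌈4 * D / ε⌉₊, fun H hH m => ?_⟩
  have hH2 : 4 * D / ε ≤ H := (Nat.le_ceil _).trans (Nat.cast_le.2 (by omega))
  rw [div_le_iff₀ hε] at hH2
  have hoff : ∀ d < D, ∀ d' < D, d' < d →
      ‖∑ h ∈ range H, a (m + h + d) * (starRingEnd ℂ) (a (m + h + d'))‖ ≤ ε ^ 2 / 8 * H := by
    intro d hdD d' _ hlt
    have hle : H₁ (d - d') ≤ H :=
      (Finset.le_sup (f := H₁) (mem_range.2 (by omega : d - d' < D))).trans (by omega)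
    -- Uniformity in the starting point is needed here: the correlation starts at `m + d'`.
    have := hH₁ (d - d') (by omega) H hle (m + d')
    refine le_of_eq_of_le ?_ this
    congr 1
    refine Finset.sum_congr rfl fun h _ => ?_
    beta_reduce
    rw [show m + d' + h + (d - d') = m + h + d by omega, show m + d' + h = m + h + d' by omega]
  have hcor : ∀ d < D, ∀ d' < D,
      ‖∑ h ∈ range H, a (m + h + d) * (starRingEnd ℂ) (a (m + h + d'))‖ ≤
        if d = d' then (H : ℝ) else ε ^ 2 / 8 * H := by
    intro d hdD d' hdD'
    split_ifs with h
    · have h1 : ∀ h ∈ range H, ‖a (m + h + d) * (starRingEnd ℂ) (a (m + h + d'))‖ ≤ 1 := by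
        intro h _
        rw [norm_mul, RCLike.norm_conj]
        exact mul_le_one₀ (ha _) (norm_nonneg _) (ha _)
      simpa using norm_sum_le_of_le _ h1
    · rcases lt_or_gt_of_ne h with h | h
      · rw [← RCLike.norm_conj, map_sum]
        refine le_of_eq_of_le ?_ (hoff d' hdD' d hdD h)
        congr 1
        refine Finset.sum_congr rfl fun h _ => ?_
        rw [map_mul, Complex.conj_conj, mul_comm]
      · exact hoff d hdD d' hdD' h
  have hsq := sum_norm_sq_sum_le a D H m hcor (by positivity)
  set S : ℕ → ℂ := fun h => ∑ d ∈ range D, a (m + h + d) with hS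
  have hcs : ‖∑ h ∈ range H, S h‖ ^ 2 ≤ H * ∑ h ∈ range H, ‖S h‖ ^ 2 := by
    calc ‖∑ h ∈ range H, S h‖ ^ 2 ≤ (∑ h ∈ range H, ‖S h‖) ^ 2 := by
          gcongr
          exact norm_sum_le _ _
      _ ≤ _ := by
          have := sq_sum_le_card_mul_sum_sq (s := range H) (f := fun h => ‖S h‖)
          simpa using this
  have hSn : ‖∑ h ∈ range H, S h‖ ≤ ε / 2 * D * H := by
    refine abs_le_of_sq_le_sq' (hcs.trans ?_) (by positivity) |>.2
    calc (H : ℝ) * ∑ h ∈ range H, ‖S h‖ ^ 2 ≤ H * (D * H + D ^ 2 * (ε ^ 2 / 8 * H)) := by gcongr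
      _ ≤ H * (D * (D * ε ^ 2 / 8) * H + D ^ 2 * (ε ^ 2 / 8 * H)) := by
          gcongr
          nlinarith
      _ = _ := by ring
  have hdiff : ‖∑ h ∈ range H, S h - D * ∑ h ∈ range H, a (m + h)‖ ≤ D * (2 * D) := by
    have : ∑ h ∈ range H, S h - D * ∑ h ∈ range H, a (m + h) =
        ∑ d ∈ range D, (∑ h ∈ range H, a (m + (h + d)) - ∑ h ∈ range H, a (m + h)) := by
      rw [Finset.sum_sub_distrib, Finset.sum_comm]
      simp [add_assoc]
    rw [this]
    rw [← nsmul_eq_mul (n := D) (a := (2 * D : ℝ)), ← card_range D, ← Finset.sum_const, card_range]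
    refine norm_sum_le_of_le _ fun d hdD => ?_
    refine (norm_sum_range_shift_sub_le (b := fun h => a (m + h)) (fun n => ha _) H d).trans ?_
    have : (d : ℝ) ≤ D := by exact_mod_cast (mem_range.1 hdD).le
    linarith
  have hfin : ‖(D : ℂ) * ∑ h ∈ range H, a (m + h)‖ ≤ D * (2 * D) + ε / 2 * D * H := by
    have := norm_sub_norm_le ((D : ℂ) * ∑ h ∈ range H, a (m + h)) (∑ h ∈ range H, S h)
    rw [norm_sub_rev] at this
    linarith
  rw [norm_mul, Complex.norm_natCast] at hfin
  refine le_of_mul_le_mul_left (hfin.trans ?_) hD0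
  nlinarith

/-! ### Weyl sums of polynomials. -/

/-- The character `x ↦ exp (2 π i x)`. -/
noncomputable def unitExp (x : ℝ) : ℂ := Complex.exp (((2 * Real.pi * x : ℝ) : ℂ) * Complex.I)

lemma norm_unitExp (x : ℝ) : ‖unitExp x‖ = 1 := Complex.norm_exp_ofReal_mul_I _

lemma unitExp_add (x y : ℝ) : unitExp (x + y) = unitExp x * unitExp y := by
  unfold unitExp
  rw [← Complex.exp_add]
  congr 1
  push_cast
  ring

lemma conj_unitExp (x : ℝ) : (starRingEnd ℂ) (unitExp x) = unitExp (-x) := by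
  unfold unitExp
  rw [← Complex.exp_conj, map_mul, Complex.conj_ofReal, Complex.conj_I]
  congr 1
  push_cast
  ring

lemma unitExp_eq_one_iff {x : ℝ} : unitExp x = 1 ↔ ∃ n : ℤ, x = n := by
  unfold unitExp
  rw [Complex.exp_eq_one_iff]
  refine exists_congr fun n => ?_
  have h2 : (2 * Real.pi * Complex.I : ℂ) ≠ 0 := Complex.two_pi_I_ne_zero
  rw [show ((2 * Real.pi * x : ℝ) : ℂ) * Complex.I = x * (2 * Real.pi * Complex.I) by
    push_cast; ring, mul_left_inj' h2]
  exact_mod_cast Iff.rfl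

lemma exists_common_denominator {Q : Polynomial ℝ} {i : ℕ}
    (hQ : ∀ j, i ≤ j → ¬ Irrational (Q.coeff j)) :
    ∃ q : ℕ, 0 < q ∧ ∀ j, i ≤ j → ∃ z : ℤ, q * Q.coeff j = z := by
  have h : ∀ s : Finset ℕ, (∀ j ∈ s, i ≤ j) →
      ∃ q : ℕ, 0 < q ∧ ∀ j ∈ s, ∃ z : ℤ, q * Q.coeff j = z := by
    intro s
    induction s using Finset.induction_on with
    | empty => exact fun _ => ⟨1, one_pos, by simp⟩
    | insert j s _ ih =>
      intro hs
      obtain ⟨q, hq, hq'⟩ := ih fun k hk => hs k (mem_insert_of_mem hk)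
      obtain ⟨r, hr⟩ := not_not.1 (hQ j (hs j (mem_insert_self j s)))
      refine ⟨q * r.den, Nat.mul_pos hq r.den_pos, fun k hk => ?_⟩
      rcases mem_insert.1 hk with rfl | hk
      · refine ⟨q * r.num, ?_⟩
        rw [← hr]
        have : ((r.den : ℚ) * r : ℚ) = r.num := Rat.den_mul_eq_num r
        have h2 : ((r.den : ℝ) * r : ℝ) = r.num := by exact_mod_cast this
        push_cast
        rw [mul_assoc, h2]
      · obtain ⟨z, hz⟩ := hq' k hk
        refine ⟨z * r.den, ?_⟩
        push_cast
        rw [← hz]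
        ring
  obtain ⟨q, hq, hq'⟩ := h (Icc i Q.natDegree) fun j hj => (mem_Icc.1 hj).1
  refine ⟨q, hq, fun j hj => ?_⟩
  by_cases hjd : j ≤ Q.natDegree
  · exact hq' j (mem_Icc.2 ⟨hj, hjd⟩)
  · exact ⟨0, by rw [Polynomial.coeff_eq_zero_of_natDegree_lt (not_le.1 hjd)]; simp⟩

/-- If `q` clears the denominators of the higher coefficients, then `Q(n + q) - Q(n)` is congruent
to `c₁ * q` mod 1, and `c₁ * q` is not an integer. -/
lemma uniformlyNullMean_of_linear_irrational {Q : Polynomial ℝ} (h1 : Irrational (Q.coeff 1))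
    (h2 : ∀ j, 2 ≤ j → ¬ Irrational (Q.coeff j)) :
    UniformlyNullMean fun n => unitExp (Q.eval (n : ℝ)) := by
  obtain ⟨q, hq, hq'⟩ := exists_common_denominator h2
  refine uniformlyNullMean_of_quasiperiodic (q := q) (z := unitExp (Q.coeff 1 * q))
    (fun n => (norm_unitExp _).le) ?_ fun n => ?_
  · rw [Ne, unitExp_eq_one_iff]
    rintro ⟨z, hz⟩
    exact (h1.mul_natCast hq.ne').ne_int z hz
  · have hdeg : 1 ≤ Q.natDegree := Polynomial.le_natDegree_of_ne_zero h1.ne_zero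
    have hint : Q.eval ((n + q : ℕ) : ℝ) - Q.eval (n : ℝ) - Q.coeff 1 * q ∈
        (Int.castRingHom ℝ).range := by
      have hsum : Q.eval ((n + q : ℕ) : ℝ) - Q.eval (n : ℝ) - Q.coeff 1 * q =
          ∑ j ∈ range (Q.natDegree + 1), (Q.coeff j * ((n + q : ℕ) : ℝ) ^ j - Q.coeff j * (n : ℝ) ^ j
            - if j = 1 then Q.coeff 1 * q else 0) := by
        rw [Finset.sum_sub_distrib, Finset.sum_sub_distrib, Finset.sum_ite_eq',
          if_pos (mem_range.2 (by omega)), Polynomial.eval_eq_sum_range,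
          Polynomial.eval_eq_sum_range]
      rw [hsum]
      refine Subring.sum_mem _ fun j _ => ?_
      rcases Nat.lt_or_ge j 2 with hj | hj
      · interval_cases j
        · simp
        · refine ⟨0, ?_⟩
          push_cast
          simp
          ring
      · obtain ⟨z, hz⟩ := hq' j hj
        obtain ⟨w, hw⟩ := sub_dvd_pow_sub_pow ((n : ℤ) + q) n j
        have hw' : ((n : ℝ) + q) ^ j - (n : ℝ) ^ j = (n + q - n) * w := by exact_mod_cast hw
        refine ⟨z * w, ?_⟩
        rw [if_neg (by omega), sub_zero, ← mul_sub]
        push_cast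
        rw [hw', eq_intCast, Int.cast_mul, ← hz]
        ring
    obtain ⟨z, hz⟩ := hint
    have he : Q.eval ((n + q : ℕ) : ℝ) = z + (Q.coeff 1 * q + Q.eval (n : ℝ)) := by
      rw [eq_intCast] at hz
      linarith
    rw [he, unitExp_add, unitExp_add, unitExp_eq_one_iff.2 ⟨z, rfl⟩, one_mul]

lemma coeff_taylor_eq_sum (Q : Polynomial ℝ) (r : ℝ) (k : ℕ) :
    (Polynomial.taylor r Q).coeff k =
      ∑ n ∈ range (Q.natDegree + 1), ((n + k).choose k : ℝ) * Q.coeff (n + k) * r ^ n := by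
  rw [Polynomial.taylor_coeff, Polynomial.eval_eq_sum_range' (n := Q.natDegree + 1)]
  · simp [Polynomial.hasseDeriv_coeff]
  · exact Nat.lt_succ_of_le ((Polynomial.natDegree_hasseDeriv_le Q k).trans (Nat.sub_le _ _))

lemma not_irrational_iff_mem {x : ℝ} : ¬ Irrational x ↔ x ∈ (algebraMap ℚ ℝ).range :=
  not_not

lemma coeff_taylor_sub_eq {Q : Polynomial ℝ} (r : ℝ) (k : ℕ) :
    (Polynomial.taylor r Q - Q).coeff k =
      ∑ n ∈ range Q.natDegree, ((n + 1 + k).choose k : ℝ) * Q.coeff (n + 1 + k) * r ^ (n + 1) := by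
  rw [Polynomial.coeff_sub, coeff_taylor_eq_sum, Finset.sum_range_succ']
  simp

/-- Weyl's theorem on exponential sums of polynomials, uniform version. -/
theorem uniformlyNullMean_of_irrational_coeff {i : ℕ} (hi : 1 ≤ i) {Q : Polynomial ℝ}
    (h1 : Irrational (Q.coeff i)) (h2 : ∀ j, i < j → ¬ Irrational (Q.coeff j)) :
    UniformlyNullMean fun n => unitExp (Q.eval (n : ℝ)) := by
  -- Induction on the highest irrational index, not on the degree: differencing lowers that index by
  -- one and keeps all higher coefficients rational.
  induction i, hi using Nat.le_induction generalizing Q with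
  | base => exact uniformlyNullMean_of_linear_irrational h1 h2
  | succ i hi ih =>
    refine uniformlyNullMean_of_differences (fun n => (norm_unitExp _).le) fun d hd => ?_
    have hfun : (fun n : ℕ => unitExp (Q.eval ((n + d : ℕ) : ℝ)) *
        (starRingEnd ℂ) (unitExp (Q.eval (n : ℝ)))) =
        fun n : ℕ => unitExp ((Polynomial.taylor (d : ℝ) Q - Q).eval (n : ℝ)) := by
      funext n
      rw [Polynomial.eval_sub, Polynomial.taylor_eval, sub_eq_add_neg, unitExp_add, conj_unitExp]
      push_cast
      rfl
    rw [hfun]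
    have hmem : ∀ k n, i + 1 < n + 1 + k →
        ((n + 1 + k).choose k : ℝ) * Q.coeff (n + 1 + k) * (d : ℝ) ^ (n + 1) ∈
          (algebraMap ℚ ℝ).range := fun k n h =>
      Subring.mul_mem _ (Subring.mul_mem _ (natCast_mem _ _) (not_irrational_iff_mem.1 (h2 _ h)))
        (Subring.pow_mem _ (natCast_mem _ _) _)
    refine ih ?_ fun j hj => ?_
    · rw [coeff_taylor_sub_eq]
      have hdeg : i + 1 ≤ Q.natDegree := Polynomial.le_natDegree_of_ne_zero h1.ne_zero
      obtain ⟨N, hN⟩ : ∃ N, Q.natDegree = N + 1 := ⟨Q.natDegree - 1, by omega⟩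
      rw [hN, Finset.sum_range_succ']
      have hrat := Subring.sum_mem (algebraMap ℚ ℝ).range (t := range N)
        (f := fun n => ((n + 1 + 1 + i).choose i : ℝ) * Q.coeff (n + 1 + 1 + i) *
          (d : ℝ) ^ (n + 1 + 1)) fun n _ => hmem i (n + 1) (by omega)
      obtain ⟨s, hs⟩ := hrat
      rw [← hs, eq_ratCast, irrational_ratCast_add_iff]
      have : ((0 + 1 + i).choose i : ℝ) * Q.coeff (0 + 1 + i) * (d : ℝ) ^ (0 + 1) =
          Q.coeff (i + 1) * (((i + 1) * d : ℕ) : ℝ) := by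
        rw [zero_add, add_comm 1 i, Nat.choose_succ_self_right]
        push_cast
        ring
      rw [this]
      exact h1.mul_natCast (by positivity)
    · rw [not_irrational_iff_mem, coeff_taylor_sub_eq]
      exact Subring.sum_mem _ fun n _ => hmem j n (by omega)


/-! ### Transfer from interval means to means along `Ω`. -/

lemma tendsto_mean_shift_cardFactors_complex {a : ℕ → ℂ} (ha : ∀ k, ‖a k‖ ≤ 1) :
    Tendsto (fun N : ℕ => (∑ n ∈ Icc 1 N, (a (cardFactors n + 1) - a (cardFactors n))) / (N : ℂ))
      atTop (𝓝 0) := by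
  have hre := tendsto_mean_shift_cardFactors (a := fun k => (a k).re)
    fun k => (Complex.abs_re_le_norm _).trans (ha k)
  have him := tendsto_mean_shift_cardFactors (a := fun k => (a k).im)
    fun k => (Complex.abs_im_le_norm _).trans (ha k)
  have h := ((Complex.continuous_ofReal.tendsto 0).comp hre).add
    (((Complex.continuous_ofReal.tendsto 0).comp him).mul_const Complex.I)
  simp only [Complex.ofReal_zero, zero_mul, add_zero] at h
  refine h.congr fun N => ?_
  simp only [Function.comp_apply, Complex.ofReal_div, Complex.ofReal_natCast, Complex.ofReal_sum,
    Complex.ofReal_sub]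
  rw [div_mul_eq_mul_div, ← add_div, Finset.sum_mul, ← Finset.sum_add_distrib]
  congr 1
  refine Finset.sum_congr rfl fun n _ => ?_
  conv_rhs => rw [← Complex.re_add_im (a (cardFactors n + 1)), ← Complex.re_add_im (a (cardFactors n))]
  ring

lemma tendsto_mean_shift_cardFactors_add {a : ℕ → ℂ} (ha : ∀ k, ‖a k‖ ≤ 1) (h : ℕ) :
    Tendsto (fun N : ℕ => (∑ n ∈ Icc 1 N, (a (cardFactors n + h) - a (cardFactors n))) / (N : ℂ))
      atTop (𝓝 0) := by
  induction h with
  | zero => simp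
  | succ h ih =>
    have h1 := (tendsto_mean_shift_cardFactors_complex fun k => ha (k + h)).add ih
    rw [add_zero] at h1
    refine h1.congr fun N => ?_
    rw [← add_div, ← Finset.sum_add_distrib]
    congr 1
    refine Finset.sum_congr rfl fun n _ => ?_
    rw [add_right_comm, add_assoc]
    ring

theorem UniformlyNullMean.tendsto_mean_cardFactors {a : ℕ → ℂ} (ha : ∀ k, ‖a k‖ ≤ 1)
    (hu : UniformlyNullMean a) :
    Tendsto (fun N : ℕ => (∑ n ∈ Icc 1 N, a (cardFactors n)) / (N : ℂ)) atTop (𝓝 0) := by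
  rw [Metric.tendsto_atTop]
  intro ε hε
  obtain ⟨H₀, hH₀⟩ := hu (ε / 2) (by positivity)
  set H := H₀ + 1 with hH
  have hHpos : (0 : ℝ) < H := by positivity
  have hlim : Tendsto (fun N : ℕ => ∑ h ∈ range H,
      (∑ n ∈ Icc 1 N, (a (cardFactors n + h) - a (cardFactors n))) / (N : ℂ)) atTop (𝓝 0) := by
    simpa using tendsto_finsetSum (range H) fun h _ => tendsto_mean_shift_cardFactors_add ha h
  obtain ⟨N₀, hN₀⟩ := Metric.tendsto_atTop.1 hlim (H * (ε / 2)) (by positivity)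
  refine ⟨N₀ + 1, fun N hN => ?_⟩
  have h1 := hN₀ N (by omega)
  have hNpos : (0 : ℝ) < N := by exact_mod_cast (by omega : 0 < N)
  rw [dist_zero_right] at h1 ⊢
  -- The mean along `Ω`, times `H`, differs from the mean of interval sums starting at `Ω n` by an
  -- error already known to vanish.
  have h2 : ∑ h ∈ range H, (∑ n ∈ Icc 1 N, (a (cardFactors n + h) - a (cardFactors n))) / (N : ℂ) =
      (∑ n ∈ Icc 1 N, ∑ h ∈ range H, a (cardFactors n + h)) / N -
        H * ((∑ n ∈ Icc 1 N, a (cardFactors n)) / N) := by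
    rw [← Finset.sum_div, Finset.sum_comm]
    simp only [Finset.sum_sub_distrib, Finset.sum_const, card_range, nsmul_eq_mul, sub_div,
      ← Finset.mul_sum]
    ring
  have h3 : ‖(∑ n ∈ Icc 1 N, ∑ h ∈ range H, a (cardFactors n + h)) / (N : ℂ)‖ ≤ ε / 2 * H := by
    rw [norm_div, Complex.norm_natCast, div_le_iff₀ hNpos]
    refine (norm_sum_le_of_le _ fun n _ => hH₀ H (by omega) (cardFactors n)).trans
      (le_of_eq ?_)
    simp
    ring
  rw [h2] at h1
  have h4 := norm_sub_norm_le ((H : ℂ) * ((∑ n ∈ Icc 1 N, a (cardFactors n)) / N))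
    ((∑ n ∈ Icc 1 N, ∑ h ∈ range H, a (cardFactors n + h)) / N)
  rw [norm_sub_rev, norm_mul, Complex.norm_natCast] at h4
  nlinarith

/-! ### Weyl's criterion through weak convergence on the circle. -/

section WeylCriterion

open MeasureTheory

instance : IsProbabilityMeasure (volume : Measure UnitAddCircle) :=
  ⟨UnitAddCircle.measure_univ⟩

/-- The empirical measure of `x 1, …, x (N + 1)` on the circle. -/
noncomputable def empiricalMeasure (x : ℕ → ℝ) (N : ℕ) : Measure UnitAddCircle :=
  ((N + 1 : ℕ) : ENNReal)⁻¹ • ∑ n ∈ Icc 1 (N + 1), Measure.dirac (x n : UnitAddCircle)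

instance (x : ℕ → ℝ) (N : ℕ) : IsProbabilityMeasure (empiricalMeasure x N) := by
  refine ⟨?_⟩
  simp only [empiricalMeasure, Measure.smul_apply, Measure.finsetSum_apply, measure_univ,
    Finset.sum_const, Nat.card_Icc, smul_eq_mul, nsmul_eq_mul, mul_one]
  exact ENNReal.inv_mul_cancel (by simp) (by simp)

lemma integral_empiricalMeasure (x : ℕ → ℝ) (N : ℕ) (f : C(UnitAddCircle, ℂ)) :
    ∫ z, f z ∂(empiricalMeasure x N) =
      (∑ n ∈ Icc 1 (N + 1), f (x n : UnitAddCircle)) / ((N + 1 : ℕ) : ℂ) := by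
  rw [empiricalMeasure, integral_smul_measure, integral_finsetSum_measure]
  · simp only [integral_dirac]
    rw [ENNReal.toReal_inv, ENNReal.toReal_natCast, Complex.real_smul, Complex.ofReal_inv,
      Complex.ofReal_natCast, inv_mul_eq_div]
  · intro n _
    exact integrable_dirac (by simp)

/-- A suitable translation negates the character and preserves the measure. -/
lemma integral_fourier_eq_zero {k : ℤ} (hk : k ≠ 0) :
    ∫ z : UnitAddCircle, (fourier k z : ℂ) = 0 :=
  integral_eq_zero_of_add_right_eq_neg (μ := volume) (fourier_add_half_inv_index hk one_pos)

/-- Characters converge by hypothesis; their span is uniformly dense, and probability measures do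
not increase the sup norm error. -/
lemma tendsto_integral_empiricalMeasure {x : ℕ → ℝ}
    (hx : ∀ k : ℤ, k ≠ 0 →
      Tendsto (fun N : ℕ => (∑ n ∈ Icc 1 N, unitExp (k * x n)) / (N : ℂ)) atTop (𝓝 0))
    (f : C(UnitAddCircle, ℂ)) :
    Tendsto (fun N => ∫ z, f z ∂(empiricalMeasure x N)) atTop (𝓝 (∫ z, f z)) := by
  have hint : ∀ (μ : Measure UnitAddCircle) [IsProbabilityMeasure μ] (g : C(UnitAddCircle, ℂ)),
      Integrable g μ := fun μ _ g => g.continuous.integrable_of_hasCompactSupport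
        (HasCompactSupport.of_compactSpace g)
  have hspan : ∀ g ∈ Submodule.span ℂ (Set.range (fourier (T := (1 : ℝ)))),
      Tendsto (fun N => ∫ z, g z ∂(empiricalMeasure x N)) atTop (𝓝 (∫ z, g z)) := by
    intro g hg
    induction hg using Submodule.span_induction with
    | mem g hg =>
      obtain ⟨k, rfl⟩ := hg
      rcases eq_or_ne k 0 with rfl | hk
      · simp
      · rw [integral_fourier_eq_zero hk]
        refine ((tendsto_add_atTop_iff_nat 1).2 (hx k hk)).congr fun N => ?_
        rw [integral_empiricalMeasure]
        congr 1
        refine Finset.sum_congr rfl fun n _ => ?_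
        rw [fourier_coe_apply, unitExp]
        congr 1
        push_cast
        ring
    | zero => simp
    | add g₁ g₂ _ _ h₁ h₂ =>
      simp only [ContinuousMap.add_apply]
      rw [integral_add (hint _ g₁) (hint _ g₂)]
      exact (h₁.add h₂).congr fun N => (integral_add (hint _ g₁) (hint _ g₂)).symm
    | smul c g _ h =>
      simp only [ContinuousMap.smul_apply, integral_smul]
      exact h.const_smul c
  have hclose : ∀ (μ : Measure UnitAddCircle) [IsProbabilityMeasure μ] (g : C(UnitAddCircle, ℂ)),
      ‖∫ z, f z ∂μ - ∫ z, g z ∂μ‖ ≤ ‖f - g‖ := by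
    intro μ _ g
    rw [← integral_sub (hint μ f) (hint μ g)]
    simpa using norm_integral_le_of_norm_le_const (μ := μ) (f := fun z => f z - g z)
      (Filter.Eventually.of_forall fun z => (f - g).norm_coe_le_norm z)
  rw [Metric.tendsto_atTop]
  intro ε hε
  have hmem : f ∈ (Submodule.span ℂ (Set.range (fourier (T := (1 : ℝ))))).topologicalClosure := by
    rw [span_fourier_closure_eq_top]
    trivial
  obtain ⟨g, hg, hfg⟩ := Metric.mem_closure_iff.1 hmem (ε / 3) (by positivity)
  rw [dist_eq_norm] at hfg
  obtain ⟨N₀, hN₀⟩ := Metric.tendsto_atTop.1 (hspan g hg) (ε / 3) (by positivity)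
  refine ⟨N₀, fun N hN => ?_⟩
  have h1 := hN₀ N hN
  have h2 := hclose (empiricalMeasure x N) g
  have h3 := hclose volume g
  rw [← dist_eq_norm] at h2 h3
  rw [dist_comm] at h3
  calc _ ≤ _ := dist_triangle4 _ _ _ _
    _ < ε / 3 + ε / 3 + ε / 3 := add_lt_add (add_lt_add (h2.trans_lt hfg) h1) (h3.trans_lt hfg)
    _ = ε := by ring

/-- The arc of the circle represented by a half-open interval. -/
def arcIco (a b : ℝ) : Set UnitAddCircle := {z | (AddCircle.equivIco 1 0 z : ℝ) ∈ Set.Ico a b}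

lemma coe_mem_arcIco {a b x : ℝ} : (x : UnitAddCircle) ∈ arcIco a b ↔ Int.fract x ∈ Set.Ico a b := by
  rw [arcIco, Set.mem_ofPred_eq, AddCircle.coe_equivIco_mk_apply]
  simp

lemma measurableSet_arcIco (a b : ℝ) : MeasurableSet (arcIco a b) :=
  (measurable_subtype_coe.comp (AddCircle.measurableEquivIco 1 0).measurable) measurableSet_Ico

lemma volume_arcIco {a b : ℝ} (ha : 0 ≤ a) (hb : b ≤ 1) :
    volume (arcIco a b) = ENNReal.ofReal (b - a) := by
  rw [AddCircle.add_projection_respects_measure 1 0 (measurableSet_arcIco a b), ← Real.volume_Ico]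
  refine measure_congr ?_
  have hnull : ∀ c : ℝ, ∀ᵐ y : ℝ, y ≠ c := fun c => Measure.ae_ne volume c
  filter_upwards [hnull 0, hnull 1] with y h0 h1
  refine propext ?_
  change (y : UnitAddCircle) ∈ arcIco a b ∧ y ∈ Set.Ioc 0 (0 + 1) ↔ y ∈ Set.Ico a b
  rw [coe_mem_arcIco]
  constructor
  · rintro ⟨h2, h3, h4⟩
    rwa [Int.fract_eq_self.2 ⟨h3.le, lt_of_le_of_ne (by linarith) h1⟩] at h2
  · intro h2
    have h3 : 0 ≤ y := ha.trans h2.1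
    have h4 : y < 1 := h2.2.trans_le hb
    rw [Int.fract_eq_self.2 ⟨h3, h4⟩]
    exact ⟨h2, lt_of_le_of_ne h3 h0.symm, by linarith⟩

lemma volume_frontier_arcIco {a b : ℝ} (ha : 0 ≤ a) (hb : b ≤ 1) :
    volume (frontier (arcIco a b)) = 0 := by
  have hsub : frontier (arcIco a b) ⊆ {(a : UnitAddCircle), (b : UnitAddCircle)} := by
    have hopen : ((↑) : ℝ → UnitAddCircle) '' Set.Ioo a b ⊆ interior (arcIco a b) := by
      refine interior_maximal ?_ (QuotientAddGroup.isOpenMap_coe _ isOpen_Ioo)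
      rintro _ ⟨y, hy, rfl⟩
      rw [coe_mem_arcIco, Int.fract_eq_self.2 ⟨ha.trans hy.1.le, hy.2.trans_le hb⟩]
      exact ⟨hy.1.le, hy.2⟩
    have hclosed : closure (arcIco a b) ⊆ ((↑) : ℝ → UnitAddCircle) '' Set.Icc a b := by
      refine closure_minimal ?_
        (isCompact_Icc.image (AddCircle.continuous_mk' 1)).isClosed
      intro z
      induction z using QuotientAddGroup.induction_on with
      | H y =>
        intro hy
        have hy' := coe_mem_arcIco.1 hy
        refine ⟨Int.fract y, ⟨hy'.1, hy'.2.le⟩, ?_⟩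
        have h0 : ((⌊y⌋ : ℝ) : UnitAddCircle) = 0 :=
          (AddCircle.coe_eq_zero_iff 1).2 ⟨⌊y⌋, by simp⟩
        rw [Int.fract, AddCircle.coe_sub, h0, sub_zero]
    rintro z ⟨hz1, hz2⟩
    obtain ⟨y, hy, rfl⟩ := hclosed hz1
    by_cases h1 : y = a
    · left; rw [h1]
    by_cases h2 : y = b
    · right; rw [h2]; rfl
    exact absurd (hopen ⟨y, ⟨lt_of_le_of_ne hy.1 (Ne.symm h1), lt_of_le_of_ne hy.2 h2⟩, rfl⟩) hz2
  have hsing : ∀ z : UnitAddCircle, volume {z} = 0 := fun z => by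
    rw [← Metric.closedBall_zero, AddCircle.volume_closedBall]
    simp
  rw [Set.insert_eq] at hsub
  exact measure_mono_null hsub (measure_union_null (hsing _) (hsing _))

/-- Weyl's criterion. -/
theorem isUniformlyDistributedModOne_of_weyl {x : ℕ → ℝ}
    (hx : ∀ k : ℤ, k ≠ 0 →
      Tendsto (fun N : ℕ => (∑ n ∈ Icc 1 N, unitExp (k * x n)) / (N : ℂ)) atTop (𝓝 0)) :
    IsUniformlyDistributedModOne x := by
  intro a b ha hab hb
  -- The shift matches `empiricalMeasure`, which uses `N + 1` points so as to be a probability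
  -- measure at `N = 0` too.
  rw [← tendsto_add_atTop_iff_nat 1]
  let μ : ProbabilityMeasure UnitAddCircle := ⟨volume, inferInstance⟩
  let μs : ℕ → ProbabilityMeasure UnitAddCircle := fun N => ⟨empiricalMeasure x N, inferInstance⟩
  have hlim : Tendsto μs atTop (𝓝 μ) := by
    rw [ProbabilityMeasure.tendsto_iff_forall_integral_rclike_tendsto ℂ]
    exact fun f => tendsto_integral_empiricalMeasure hx f.toContinuousMap
  -- Portmanteau: the frontier of the arc is contained in its two endpoints.
  have h1 := ProbabilityMeasure.tendsto_measure_of_null_frontier_of_tendsto' hlim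
    (E := arcIco a b) (volume_frontier_arcIco ha hb)
  have h2 := (ENNReal.tendsto_toReal (measure_ne_top _ _)).comp h1
  have h3 : ((μ : Measure UnitAddCircle) (arcIco a b)).toReal = b - a := by
    change (volume (arcIco a b)).toReal = b - a
    rw [volume_arcIco ha hb, ENNReal.toReal_ofReal (by linarith)]
  rw [h3] at h2
  refine h2.congr fun N => ?_
  change ((empiricalMeasure x N) (arcIco a b)).toReal = _
  have hind : ∀ n, (arcIco a b).indicator (1 : UnitAddCircle → ENNReal) (x n : UnitAddCircle) =
      if Int.fract (x n) ∈ Set.Ico a b then 1 else 0 := fun n => by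
    split_ifs with h
    · exact Set.indicator_of_mem (coe_mem_arcIco.2 h) _
    · exact Set.indicator_of_notMem (fun h' => h (coe_mem_arcIco.1 h')) _
  simp only [empiricalMeasure, Measure.smul_apply, Measure.finsetSum_apply, smul_eq_mul,
    Measure.dirac_apply' _ (measurableSet_arcIco a b), ENNReal.toReal_mul, ENNReal.toReal_inv,
    ENNReal.toReal_natCast, hind]
  rw [Finset.sum_boole, ENNReal.toReal_natCast, inv_mul_eq_div]

end WeylCriterion

/-! ### The rational case and the conclusion. -/

/-- If `c` is not in `[a, b)`, no fractional part of `x n` falls in `[a / q, b / q)`. One of the two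
halves of `[0, 1)` omits `c`. -/
lemma not_isUniformlyDistributedModOne_of_fract_const {x : ℕ → ℝ} {q : ℕ} (hq : 0 < q) {c : ℝ}
    (hx : ∀ n, Int.fract (q * x n) = c) : ¬ IsUniformlyDistributedModOne x := by
  intro h
  have hq' : (0 : ℝ) < q := by exact_mod_cast hq
  have hq1 : (1 : ℝ) ≤ q := by exact_mod_cast hq
  have key : ∀ a b : ℝ, 0 ≤ a → a < b → b ≤ 1 → c ∉ Set.Ico a b → False := by
    intro a b ha hab hb hc
    have hlim := h (a / q) (b / q) (by positivity) (by gcongr)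
      ((div_le_one hq').2 (hb.trans hq1))
    have hzero : ∀ N : ℕ, #{n ∈ Icc 1 N | Int.fract (x n) ∈ Set.Ico (a / q) (b / q)} = 0 := by
      intro N
      rw [Finset.card_eq_zero, Finset.filter_eq_empty_iff]
      rintro n - ⟨h1, h2⟩
      rw [div_le_iff₀ hq'] at h1
      rw [lt_div_iff₀ hq'] at h2
      refine hc ?_
      rw [← hx n]
      have hfr : Int.fract (q * x n) = q * Int.fract (x n) := by
        rw [Int.fract_eq_iff]
        refine ⟨by linarith, by linarith, q * ⌊x n⌋, ?_⟩
        push_cast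
        rw [← mul_sub, Int.self_sub_fract]
      rw [hfr, mul_comm]
      exact ⟨h1, h2⟩
    simp only [hzero, Nat.cast_zero, zero_div] at hlim
    have := tendsto_nhds_unique hlim tendsto_const_nhds
    rw [← sub_div] at this
    exact (div_pos (sub_pos.2 hab) hq').ne' this
  rcases lt_or_ge c (1 / 2) with hc | hc
  · exact key (1 / 2) 1 (by norm_num) (by norm_num) le_rfl fun h => absurd h.1 (not_le.2 hc)
  · exact key 0 (1 / 2) le_rfl (by norm_num) (by norm_num) fun h => absurd h.2 (not_lt.2 hc)

lemma fract_mul_eval_natCast {Q : Polynomial ℝ} {q : ℕ}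
    (hq : ∀ j, 1 ≤ j → ∃ z : ℤ, q * Q.coeff j = z) (n : ℕ) :
    Int.fract (q * Q.eval (n : ℝ)) = Int.fract (q * Q.coeff 0) := by
  rw [Int.fract_eq_fract, Polynomial.eval_eq_sum_range, Finset.sum_range_succ', mul_add, pow_zero,
    mul_one, add_sub_cancel_right, Finset.mul_sum]
  choose! z hz using hq
  refine ⟨∑ j ∈ range Q.natDegree, z (j + 1) * (n : ℤ) ^ (j + 1), ?_⟩
  push_cast
  refine Finset.sum_congr rfl fun j _ => ?_
  rw [← hz (j + 1) (by omega)]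
  ring

theorem mainTheorem6 (Q : Polynomial ℝ) :
    IsUniformlyDistributedModOne
        (fun n : ℕ => Q.eval ((ArithmeticFunction.cardFactors n : ℕ) : ℝ)) ↔
      ∃ i : ℕ, 1 ≤ i ∧ Irrational (Q.coeff i) := by
  classical
  constructor
  · intro h
    by_contra! hcon
    obtain ⟨q, hq, hq'⟩ := exists_common_denominator hcon
    exact not_isUniformlyDistributedModOne_of_fract_const hq
      (fun n => fract_mul_eval_natCast hq' _) h
  · rintro ⟨i₀, hi₀, hirr₀⟩
    have hbound : ∀ j, Irrational (Q.coeff j) → j ≤ Q.natDegree := fun j hj =>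
      Polynomial.le_natDegree_of_ne_zero hj.ne_zero
    set i := Nat.findGreatest (fun j => Irrational (Q.coeff j)) Q.natDegree with hi
    have hi1 : 1 ≤ i := hi₀.trans (Nat.le_findGreatest (hbound _ hirr₀) hirr₀)
    have hirr : Irrational (Q.coeff i) :=
      Nat.findGreatest_spec (P := fun j => Irrational (Q.coeff j)) (hbound _ hirr₀) hirr₀
    have hmax : ∀ j, i < j → ¬ Irrational (Q.coeff j) := fun j hj hj' =>
      absurd (Nat.le_findGreatest (hbound j hj') hj') (not_le.2 hj)
    refine isUniformlyDistributedModOne_of_weyl fun k hk => ?_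
    -- Multiplication by a nonzero integer `k` preserves the highest irrational index, so the Weyl
    -- sums of `k * Q` are covered.
    have hu := uniformlyNullMean_of_irrational_coeff (Q := Polynomial.C (k : ℝ) * Q) hi1
      (by rw [Polynomial.coeff_C_mul]; exact hirr.intCast_mul hk)
      (fun j hj => by
        rw [Polynomial.coeff_C_mul, not_irrational_iff_mem]
        exact Subring.mul_mem _ (intCast_mem _ _) (not_irrational_iff_mem.1 (hmax j hj)))
    have := hu.tendsto_mean_cardFactors fun n => (norm_unitExp _).le
    simpa only [Polynomial.eval_mul, Polynomial.eval_C] using this
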